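/- Let $F$ be a field of characteristic zero. A trace algebra is a nonzero unitary associative $F$-algebra $A$ with a linear map $\mathrm{tr}\colon A\to F$ such that $\mathrm{tr}(ab)=\mathrm{tr}(ba)$ for all $a,b\in A$. Let $X=\{x_1,x_2,\dots\}$. The free algebra with trace is $F\langle X,\mathrm{Tr}\rangle = F\langle X\rangle\otimes F[\mathrm{Tr}(M)]$, where $M$ runs over the nonempty monomials in $X$, the $\mathrm{Tr}(M)$ are commuting central variables, and $\mathrm{Tr}(MN)=\mathrm{Tr}(NM)$. Let $\mathrm{Id}^{tr}(A)$ be the set of all $f\in F\langle X,\mathrm{Tr}\rangle$ that vanish whenever the $x_i$ are replaced by elements of $A$ and $\mathrm{Tr}$ by $\mathrm{tr}$ (with $F$ identified with $F\cdot 1_A$). Write $A\in\mathrm{var}^{tr}(B)$ if $\mathrm{Id}^{tr}(B)\subseteq \mathrm{Id}^{tr}(A)$, and $A\sim_{T^{tr}}B$ if $\mathrm{Id}^{tr}(A)=\mathrm{Id}^{tr}(B)$. Let $D_2^{t_{\alpha,\beta}}$ be the algebra of diagonal $2\times2$ matrices over $F$ with trace $\mathrm{diag}(a,b)\mapsto\alpha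 a+\beta b$. For $k\ge1$ let $C_k$ be the algebra of upper triangular $k\times k$ matrices over $F$ that are constant along each diagonal; let $C_k^{t_{\alpha,0}}$ be $C_k$ with the trace whose value on a matrix with diagonal entry $a$ is $\alpha a$, and let $C_2^{t_{\alpha,\beta}}$ be $C_2$ with trace $\begin{pmatrix}a&b\\0&a\end{pmatrix}\mapsto\alpha a+\beta b$. **Theorem.** Let $A$ be a finite dimensional trace algebra with trace $\mathrm{tr}$, and let $B$ be one of $D_2^{t_{\alpha',\beta}}$ (with $\alpha',\beta\in F\setminus\{0\}$, $\alpha'\neq\beta$), $D_2^{t_{\gamma,\gamma}}$ (with $\gamma\in F\setminus\{0\}$), $D_2^{t_{\delta,0}}$ (with $\delta\in F\setminus\{0\}$), $C_2^{t_{\epsilon,1}}$ (with $\epsilon\in F$). If $A\in\mathrm{var}^{tr}(B)$, then either $A\sim_{T^{tr}}B$, or $A\sim_{T^{tr}}C_k^{t_{\alpha,0}}$ for some $k\ge1$, where $\alpha=\mathrm{tr}(1_A)$. -/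

import Mathlib

open scoped TensorProduct

namespace TraceAlgebra

universe u v w

/-- A trace on a unitary associative `F`-algebra `A`: a linear map `tr : A → F` with
`tr (a * b) = tr (b * a)`. -/
structure AlgTrace (F : Type u) (A : Type v) [Field F] [Ring A] [Algebra F A] where
  toLinearMap : A →ₗ[F] F
  map_mul_comm : ∀ a b : A, toLinearMap (a * b) = toLinearMap (b * a)

/-- The nonempty monomials in the variables `x_0, x_1, …`, up to cyclic permutation of the factors.
They index the formal traces `Tr(M)`, which are subject to `Tr(MN) = Tr(NM)`. -/
abbrev CyclicMonomial : Type := {c : Cycle ℕ // c ≠ Cycle.nil}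

/-- The free algebra with trace `F⟨X, Tr⟩ = F⟨X⟩ ⊗ F[Tr(M) | M a monomial]` on a countable set of
generators; its elements are the trace polynomials. -/
abbrev TracePoly (F : Type u) [Field F] : Type u :=
  FreeAlgebra F ℕ ⊗[F] MvPolynomial CyclicMonomial F

section Identities

variable {F : Type u} {A : Type v} [Field F] [Ring A] [Algebra F A]

theorem AlgTrace.map_prod_of_isRotated (t : AlgTrace F A) (a : ℕ → A) {l l' : List ℕ}
    (h : l ~r l') :
    t.toLinearMap (l.map a).prod = t.toLinearMap (l'.map a).prod := by
  obtain ⟨n, hn, rfl⟩ := List.isRotated_iff_mod.1 h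
  rw [List.rotate_eq_drop_append_take hn, List.map_append, List.prod_append, t.map_mul_comm,
    ← List.prod_append, ← List.map_append, List.take_append_drop]

/-- The value `tr (a_{i_1} ⋯ a_{i_r})` of the formal trace of the cyclic monomial
`x_{i_1} ⋯ x_{i_r}` at `a`. -/
def AlgTrace.cycleValue (t : AlgTrace F A) (a : ℕ → A) (c : Cycle ℕ) : F :=
  Quotient.lift (s := List.IsRotated.setoid ℕ) (fun l : List ℕ => t.toLinearMap (l.map a).prod)
    (fun _ _ h => t.map_prod_of_isRotated a h) c

/-- Evaluation of trace polynomials: `x_i` is replaced by `a i` and `Tr` by the trace `t`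
(with `F` identified with `F · 1 ⊆ A`). -/
noncomputable def AlgTrace.eval (t : AlgTrace F A) (a : ℕ → A) : TracePoly F →ₐ[F] A :=
  Algebra.TensorProduct.lift (FreeAlgebra.lift F a)
    ((Algebra.ofId F A).comp (MvPolynomial.aeval fun c : CyclicMonomial => t.cycleValue a c.1))
    (fun x y => by
      rw [AlgHom.comp_apply, Algebra.ofId_apply]
      exact Algebra.commute_algebraMap_right _ _)

/-- `Id^tr(A)`: the set of trace identities of `A`. -/
def AlgTrace.identities (t : AlgTrace F A) : Set (TracePoly F) :=
  {f | ∀ a : ℕ → A, t.eval a f = 0}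

/-- `A ∈ var^tr(B)`: the algebra `A` satisfies every trace identity of `B`. -/
def AlgTrace.MemVariety {B : Type w} [Ring B] [Algebra F B]
    (t : AlgTrace F A) (s : AlgTrace F B) : Prop :=
  s.identities ⊆ t.identities

/-- `T^tr`-equivalence: `A` and `B` have the same trace identities. -/
def AlgTrace.TEquiv {B : Type w} [Ring B] [Algebra F B]
    (t : AlgTrace F A) (s : AlgTrace F B) : Prop :=
  t.identities = s.identities

end Identities

/-- The algebra `D_n` of diagonal `n × n` matrices. -/
def diagonalAlgebra (F : Type u) [Field F] (n : ℕ) : Subalgebra F (Matrix (Fin n) (Fin n) F) :=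
  (Matrix.diagonalAlgHom F (n := Fin n) (α := F)).range

/-- The trace `t_{α_1, …, α_n}` on `D_n`: `diag(a_1, …, a_n) ↦ α_1 a_1 + ⋯ + α_n a_n`. -/
def diagonalTrace {F : Type u} [Field F] {n : ℕ} (α : Fin n → F) :
    AlgTrace F (diagonalAlgebra F n) where
  toLinearMap :=
    { toFun := fun a => ∑ i, α i * a.1 i i
      map_add' := fun a b => by simp [mul_add, Finset.sum_add_distrib]
      map_smul' := fun c a => by simp [Finset.mul_sum, mul_left_comm] }
  map_mul_comm := by
    rintro ⟨_, a, rfl⟩ ⟨_, b, rfl⟩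
    rw [show (⟨_, a, rfl⟩ : diagonalAlgebra F n) * ⟨_, b, rfl⟩ = ⟨_, b, rfl⟩ * ⟨_, a, rfl⟩ from
      Subtype.ext (by
        change Matrix.diagonalAlgHom F a * Matrix.diagonalAlgHom F b =
          Matrix.diagonalAlgHom F b * Matrix.diagonalAlgHom F a
        rw [← map_mul, ← map_mul, mul_comm])]

/-- The algebra `C_k` of the upper triangular `k × k` matrices with constant diagonals: the `(i, j)`
entry is `c (j - i)` for `i ≤ j`, and zero below the diagonal. -/
def toeplitzAlgebra (F : Type u) [Field F] (k : ℕ) : Subalgebra F (Matrix (Fin k) (Fin k) F) where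
  carrier := {M | ∃ c : ℕ → F, ∀ i j : Fin k,
    M i j = if i ≤ j then c ((j : ℕ) - (i : ℕ)) else 0}
  mul_mem' := by
    rintro M N ⟨c, hc⟩ ⟨d, hd⟩
    refine ⟨fun m => ∑ p ∈ Finset.range (m + 1), c p * d (m - p), fun i j => ?_⟩
    rw [Matrix.mul_apply]
    simp only [hc, hd]
    split_ifs with hij
    · have hij' : (i : ℕ) ≤ j := hij
      symm
      refine Finset.sum_bij_ne_zero
        (fun p hp _ => (⟨i + p, by have := Finset.mem_range.1 hp; omega⟩ : Fin k))
        (fun _ _ _ => Finset.mem_univ _) ?_ ?_ ?_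
      · intro p _ _ q _ _ h
        simpa using h
      · intro l _ hl
        have h1 : i ≤ l := by by_contra h; simp [h] at hl
        have h2 : l ≤ j := by by_contra h; simp [h] at hl
        have h1' : (i : ℕ) ≤ l := h1
        have h2' : (l : ℕ) ≤ j := h2
        have h3 : (j : ℕ) - i - (l - i) = j - l := by omega
        refine ⟨l - i, Finset.mem_range.2 (by omega), ?_, ?_⟩
        · simpa [h1, h2, h3] using hl
        · ext; simp; omega
      · intro p hp _
        have := Finset.mem_range.1 hp
        have h1 : i ≤ (⟨i + p, by omega⟩ : Fin k) := by
          rw [Fin.le_def]; simp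
        have h2 : (⟨i + p, by omega⟩ : Fin k) ≤ j := by
          rw [Fin.le_def]; simp; omega
        have h3 : (j : ℕ) - (i + p) = j - i - p := by omega
        simp [h1, h2, h3]
    · refine Finset.sum_eq_zero fun l _ => ?_
      by_cases h1 : i ≤ l
      · have h2 : ¬ l ≤ j := fun h => hij (h1.trans h)
        simp [h2]
      · simp [h1]
  add_mem' := by
    rintro M N ⟨c, hc⟩ ⟨d, hd⟩
    refine ⟨fun m => c m + d m, fun i j => ?_⟩
    rw [Matrix.add_apply, hc, hd]
    split_ifs <;> simp
  algebraMap_mem' := by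
    intro r
    refine ⟨fun m => if m = 0 then r else 0, fun i j => ?_⟩
    rw [Matrix.algebraMap_matrix_apply]
    by_cases h : i = j
    · subst h; simp
    · by_cases hij : i ≤ j
      · have : (j : ℕ) - i ≠ 0 := by
          have h1 : (i : ℕ) ≤ j := hij
          have h2 : (i : ℕ) ≠ j := fun e => h (Fin.ext e)
          omega
        simp [h, this]
      · simp [h, hij]

theorem toeplitzAlgebra_comm {F : Type u} [Field F] {k : ℕ} (a b : toeplitzAlgebra F k) :
    a * b = b * a := by
  obtain ⟨M, c, hc⟩ := a
  obtain ⟨N, d, hd⟩ := b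
  refine Subtype.ext (Matrix.ext fun i j => ?_)
  change (M * N) i j = (N * M) i j
  rw [Matrix.mul_apply, Matrix.mul_apply]
  simp only [hc, hd]
  refine Finset.sum_bij_ne_zero
    (fun l _ hl => (⟨i + j - l, ?_⟩ : Fin k)) (fun _ _ _ => Finset.mem_univ _) ?_ ?_ ?_
  · have h1 : i ≤ l := by by_contra h; simp [h] at hl
    have h1' : (i : ℕ) ≤ l := h1
    omega
  · intro l _ hl m _ hm h
    have h1 : l ≤ j := by by_contra h; simp [h] at hl
    have h2 : m ≤ j := by by_contra h; simp [h] at hm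
    have h1' : (l : ℕ) ≤ j := h1
    have h2' : (m : ℕ) ≤ j := h2
    have h' : (i : ℕ) + j - l = i + j - m := congrArg Fin.val h
    ext; omega
  · intro l _ hl
    have h1 : i ≤ l := by by_contra h; simp [h] at hl
    have h2 : l ≤ j := by by_contra h; simp [h] at hl
    have h1' : (i : ℕ) ≤ l := h1
    have h2' : (l : ℕ) ≤ j := h2
    have h3 : i ≤ (⟨i + j - l, by omega⟩ : Fin k) := by rw [Fin.le_def]; simp; omega
    have h4 : (⟨i + j - l, by omega⟩ : Fin k) ≤ j := by rw [Fin.le_def]; simp; omega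
    have h5 : (i : ℕ) + j - l - i = j - l := by omega
    have h6 : (j : ℕ) - (i + j - l) = l - i := by omega
    refine ⟨⟨i + j - l, by omega⟩, Finset.mem_univ _, ?_, ?_⟩
    · simp only [h1, h2, if_true] at hl
      simpa [h3, h4, h5, h6, mul_comm] using hl
    · ext; simp; omega
  · intro l _ hl
    have h1 : i ≤ l := by by_contra h; simp [h] at hl
    have h2 : l ≤ j := by by_contra h; simp [h] at hl
    have h1' : (i : ℕ) ≤ l := h1
    have h2' : (l : ℕ) ≤ j := h2
    have h3 : i ≤ (⟨i + j - l, by omega⟩ : Fin k) := by rw [Fin.le_def]; simp; omega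
    have h4 : (⟨i + j - l, by omega⟩ : Fin k) ≤ j := by rw [Fin.le_def]; simp; omega
    have h5 : (i : ℕ) + j - l - i = j - l := by omega
    have h6 : (j : ℕ) - (i + j - l) = l - i := by omega
    simp [h1, h2, h3, h4, h5, h6, mul_comm]

/-- The trace `t_{α,0}` on `C_k`, `k ≥ 1`: the value at a matrix with diagonal entry `a` is
`α a`. -/
def toeplitzTrace {F : Type u} [Field F] (k : ℕ) [NeZero k] (α : F) :
    AlgTrace F (toeplitzAlgebra F k) where
  toLinearMap :=
    { toFun := fun a => α * a.1 0 0
      map_add' := fun a b => by simp [mul_add]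
      map_smul' := fun c a => by simp [mul_left_comm] }
  map_mul_comm := fun a b => by rw [toeplitzAlgebra_comm]

/-- The strange trace `t_{α,β}` on `C_2`: the matrix with rows `(a, b)` and `(0, a)` is sent to
`α a + β b`. -/
def strangeTrace {F : Type u} [Field F] (α β : F) : AlgTrace F (toeplitzAlgebra F 2) where
  toLinearMap :=
    { toFun := fun a => α * a.1 0 0 + β * a.1 0 1
      map_add' := fun a b => by simp only [Subalgebra.coe_add, Matrix.add_apply]; ring
      map_smul' := fun c a => by
        simp only [Subalgebra.coe_smul, Matrix.smul_apply, smul_eq_mul, RingHom.id_apply]; ring }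
  map_mul_comm := fun a b => by rw [toeplitzAlgebra_comm]

end TraceAlgebra

/-! Each algebra B in the list is commutative, so A is commutative too, and a few explicit
identities of B show that A either carries the structure of B or has a trace proportional to a
character with bounded nil kernel.

The second outcome always gives some C_k. If tr = δφ for a character φ, splitting each element into
a scalar and a part in ker φ turns a trace polynomial into an ordinary polynomial in elements of ker
φ. Whether it vanishes depends only on δ and on the exponents d with x^d = 0 on ker φ
(`AlgTrace.identities_subset_of_character`), and C_k realises nil index exactly k. A zero trace or
an algebra of scalars also falls under this outcome.

For D_2 with α, β nonzero, the discriminant (α+β)tr(x²) - tr(x)² decides. If it vanishes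
identically, then either tr = 0 or x - tr(x)/(α+β) is always nilpotent, which forces a character. If
it is nonzero at some x and α ≠ β, the third moment tells the two coordinates apart, and trace
expressions in x give an idempotent e with eA and (1-e)A of dimension at most one; so A consists of
scalars or contains a copy of D_2 with the right trace. If α = β, the trace is symmetric and only a
square root v of a scalar is available, possibly generating a quadratic field extension; A is then a
form of D_2, and the identities are compared through polynomials in v.

For C_2 the dichotomy is the same, with tr(x)² - ε tr(x²) as discriminant. For D_2 with weights δ,
0, δ⁻¹tr is a character unless tr = 0; if its kernel has no bounded nil index, every identity of A
already holds in B. -/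

namespace TraceAlgebra

universe u v w

/-! ### Evaluation of trace polynomials and linearisation over infinite fields -/

section General

variable {F : Type u} {A : Type v} [Field F]

/-- The variable `x_i` as a trace polynomial. -/
noncomputable def varPoly (F : Type u) [Field F] (i : ℕ) : TracePoly F :=
  FreeAlgebra.ι F i ⊗ₜ[F] 1

/-- The formal trace of the monomial `x_i x_{l_1} ⋯ x_{l_r}`. -/
noncomputable def tracePoly (F : Type u) [Field F] (i : ℕ) (l : List ℕ) : TracePoly F :=
  1 ⊗ₜ[F] MvPolynomial.X ⟨((i :: l : List ℕ) : Cycle ℕ), by simp⟩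

@[simp]
theorem AlgTrace.eval_varPoly [Ring A] [Algebra F A] (t : AlgTrace F A) (a : ℕ → A) (i : ℕ) :
    t.eval a (varPoly F i) = a i := by
  simp [AlgTrace.eval, varPoly]

@[simp]
theorem AlgTrace.eval_tracePoly [Ring A] [Algebra F A] (t : AlgTrace F A) (a : ℕ → A) (i : ℕ)
    (l : List ℕ) :
    t.eval a (tracePoly F i l) = algebraMap F A (t.toLinearMap (a i * (l.map a).prod)) := by
  simp [AlgTrace.eval, tracePoly, AlgTrace.cycleValue, Algebra.ofId_apply]
  rfl

/-- Evaluation of trace polynomials in a commutative algebra, the formal trace being replaced by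
an arbitrary linear endomorphism. -/
noncomputable def endoEval {R : Type v} [CommRing R] [Algebra F R] (τ : R →ₗ[F] R) (a : ℕ → R) :
    TracePoly F →ₐ[F] R :=
  Algebra.TensorProduct.lift (FreeAlgebra.lift F a)
    (MvPolynomial.aeval fun c : CyclicMonomial => τ (c.1.toMultiset.map a).prod)
    (fun _ _ => Commute.all _ _)

theorem AlgTrace.cycleValue_eq [CommRing A] [Algebra F A] (t : AlgTrace F A) (a : ℕ → A)
    (c : Cycle ℕ) : t.cycleValue a c = t.toLinearMap (c.toMultiset.map a).prod := by
  induction c using Quotient.inductionOn with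
  | h l =>
    change t.toLinearMap (l.map a).prod = t.toLinearMap ((l : Multiset ℕ).map a).prod
    rw [Multiset.map_coe, Multiset.prod_coe]

/-- This permits computing in a generic algebra R, where the formal trace becomes an endomorphism τ
and no longer needs scalar values, and specialising afterwards along ψ. -/
theorem AlgTrace.eval_comp {R : Type w} [CommRing R] [Algebra F R] [CommRing A] [Algebra F A]
    (t : AlgTrace F A) (τ : R →ₗ[F] R) (ψ : R →ₐ[F] A)
    (h : ∀ p, ψ (τ p) = algebraMap F A (t.toLinearMap (ψ p))) (a : ℕ → R) (f : TracePoly F) :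
    t.eval (fun i => ψ (a i)) f = ψ (endoEval τ a f) := by
  suffices H : t.eval (fun i => ψ (a i)) = ψ.comp (endoEval τ a) from
    DFunLike.congr_fun H f
  apply Algebra.TensorProduct.ext
  · apply FreeAlgebra.hom_ext
    funext i
    simp [AlgTrace.eval, endoEval]
  · apply MvPolynomial.algHom_ext
    intro c
    simp [AlgTrace.eval, endoEval, h, AlgTrace.cycleValue_eq, Algebra.ofId_apply, map_multiset_prod]

theorem AlgTrace.map_eval {B : Type w} [Ring A] [Algebra F A] [Ring B] [Algebra F B]
    (t : AlgTrace F A) (s : AlgTrace F B) (ψ : B →ₐ[F] A)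
    (h : ∀ b, t.toLinearMap (ψ b) = s.toLinearMap b) (b : ℕ → B) (f : TracePoly F) :
    t.eval (fun i => ψ (b i)) f = ψ (s.eval b f) := by
  suffices H : t.eval (fun i => ψ (b i)) = ψ.comp (s.eval b) from
    DFunLike.congr_fun H f
  apply Algebra.TensorProduct.ext
  · apply FreeAlgebra.hom_ext
    funext i
    simp [AlgTrace.eval]
  · apply MvPolynomial.algHom_ext
    rintro ⟨c, hc⟩
    induction c using Quotient.inductionOn with
    | h l =>
      simp only [AlgTrace.eval, AlgTrace.cycleValue, AlgHom.comp_apply,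
        Algebra.TensorProduct.includeRight_apply, Algebra.TensorProduct.lift_tmul, map_one,
        one_mul, MvPolynomial.aeval_X, Algebra.ofId_apply, Quotient.lift_mk, AlgHom.commutes,
        AlgHom.coe_restrictScalars']
      rw [← h, map_list_prod ψ, List.map_map]
      rfl

/-- If `B` embeds into `A` compatibly with the traces, then every identity of `A` holds in `B`. -/
theorem AlgTrace.identities_subset_of_injective {B : Type w} [Ring A] [Algebra F A] [Ring B]
    [Algebra F B] (t : AlgTrace F A) (s : AlgTrace F B) (ψ : B →ₐ[F] A)
    (hψ : Function.Injective ψ) (h : ∀ b, t.toLinearMap (ψ b) = s.toLinearMap b) :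
    t.identities ⊆ s.identities := by
  intro f hf b
  apply hψ
  rw [map_zero, ← t.map_eval s ψ h]
  exact hf _

/-- A polynomial function on an infinite field with values in a vector space vanishes only if its
coefficients do. -/
theorem eq_zero_of_sum_pow_smul_eq_zero [Infinite F] {V : Type v} [AddCommGroup V] [Module F V]
    (s : Finset ℕ) (v : ℕ → V) (h : ∀ c : F, ∑ j ∈ s, c ^ j • v j = 0) :
    ∀ j ∈ s, v j = 0 := by
  intro j hj
  rw [← Module.forall_dual_apply_eq_zero_iff F]
  intro ℓ
  have hp : (∑ j ∈ s, Polynomial.monomial j (ℓ (v j))) = 0 := by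
    apply Polynomial.funext
    intro c
    have := congrArg ℓ (h c)
    simpa [Polynomial.eval_finsetSum, mul_comm] using this
  have := congrArg (fun p => Polynomial.coeff p j) hp
  simpa [Polynomial.finsetSum_coeff, Polynomial.coeff_monomial, hj] using this

/-- Polarisation: the coefficient of c in (c y + x)^(d+1) z is (d+1) x^d y z, and d+1 is invertible.
The extra factor z absorbs y and so carries the induction. -/
theorem prod_mul_eq_zero_of_forall_pow_mul_eq_zero [CharZero F] [CommRing A] [Algebra F A]
    (I : Submodule F A) (d : ℕ) :
    ∀ z : A, (∀ x ∈ I, x ^ d * z = 0) → ∀ s : Multiset A, s.card = d → (∀ y ∈ s, y ∈ I) →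
      s.prod * z = 0 := by
  induction d with
  | zero =>
    intro z hz s hs _
    have := hz 0 I.zero_mem
    rw [Multiset.card_eq_zero] at hs
    subst hs
    simpa using this
  | succ d ih =>
    intro z hz s hs hI
    obtain ⟨y, hys⟩ := Multiset.card_pos_iff_exists_mem.1 (by omega : 0 < s.card)
    obtain ⟨s, rfl⟩ := Multiset.exists_cons_of_mem hys
    have hy : y ∈ I := hI y (by simp)
    have key : ∀ x ∈ I, x ^ d * (y * z) = 0 := by
      intro x hx
      have h1 := eq_zero_of_sum_pow_smul_eq_zero (F := F) (Finset.range (d + 1 + 1))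
        (fun j => y ^ j * x ^ (d + 1 - j) * ((d + 1).choose j : A) * z) (fun c => by
          have := hz (c • y + x) (I.add_mem (I.smul_mem c hy) hx)
          rw [add_pow, Finset.sum_mul] at this
          simpa [smul_pow, smul_mul_assoc] using this) 1 (by simp)
      simp only [pow_one, Nat.add_sub_cancel, Nat.choose_one_right] at h1
      have h2 : ((d + 1 : ℕ) : F) • (x ^ d * (y * z)) = 0 := by
        rw [Algebra.smul_def, map_natCast, ← h1]
        ring
      exact (smul_eq_zero.1 h2).resolve_left (by exact_mod_cast d.succ_ne_zero)
    have := ih (y * z) key s (by simpa using hs) (fun w hw => hI w (by simp [hw]))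
    rw [Multiset.prod_cons, ← this]
    ring

end General

/-! ### Traces proportional to a character -/

section Characters

variable {F : Type u} {A : Type v} {B : Type w} [Field F]

theorem aeval_smul_of_isHomogeneous [CommRing A] [Algebra F A] {Q : MvPolynomial ℕ F} {d : ℕ}
    (hQ : Q.IsHomogeneous d) (e : ℕ → F) (x : A) :
    MvPolynomial.aeval (fun i => e i • x) Q = MvPolynomial.eval e Q • x ^ d := by
  rw [MvPolynomial.aeval_def, MvPolynomial.eval₂_eq, MvPolynomial.eval_eq, Finset.sum_smul]
  refine Finset.sum_congr rfl fun m hm => ?_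
  have hd : ∑ i ∈ m.support, m i = d := by
    have := hQ (MvPolynomial.mem_support_iff.1 hm)
    rwa [Finsupp.weight_apply, Finsupp.sum, Finset.sum_congr rfl (g := fun i => m i)
      (fun i _ => by simp)] at this
  simp only [Algebra.smul_def, mul_pow, Finset.prod_mul_distrib, Finset.prod_pow_eq_pow_sum, hd,
    map_mul, map_prod, map_pow]
  ring

/-- For traces proportional to characters, the identities depend only on which powers vanish on
the kernel of the character. -/
theorem AlgTrace.identities_subset_of_character_aux [CharZero F] [CommRing A] [Algebra F A]
    [CommRing B] [Algebra F B] (t : AlgTrace F A) (s : AlgTrace F B) (φ : A →ₐ[F] F)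
    (χ : B →ₐ[F] F) (δ : F) (ht : ∀ x, t.toLinearMap x = δ * φ x)
    (hs : ∀ x, s.toLinearMap x = δ * χ x)
    (h : ∀ d, (∀ x, φ x = 0 → x ^ d = 0) → ∀ x, χ x = 0 → x ^ d = 0) :
    t.identities ⊆ s.identities := by
  intro f hf b
  set c : ℕ → F := fun i => χ (b i) with hc
  set n : ℕ → B := fun i => b i - algebraMap F B (c i) with hn
  have hχn : ∀ i, χ (n i) = 0 := fun i => by simp [hn, hc]
  -- In the generic model the variables stand for elements of the kernel of the character, so the
  -- character is the constant term and the trace is δ times it.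
  let τ : MvPolynomial ℕ F →ₗ[F] MvPolynomial ℕ F :=
    (Algebra.linearMap F (MvPolynomial ℕ F)).comp
      (δ • (MvPolynomial.aeval (fun _ : ℕ => (0 : F))).toLinearMap)
  set P := endoEval τ (fun i => MvPolynomial.C (c i) + MvPolynomial.X i) f with hP
  have hA : ∀ m : ℕ → A, (∀ i, φ (m i) = 0) → MvPolynomial.aeval m P = 0 := by
    intro m hm
    have hφ : φ.comp (MvPolynomial.aeval m) = MvPolynomial.aeval (fun _ : ℕ => (0 : F)) :=
      MvPolynomial.algHom_ext fun i => by simp [hm]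
    rw [hP, ← t.eval_comp τ (MvPolynomial.aeval m) fun p => by
      rw [ht, ← AlgHom.comp_apply, hφ]
      simp [τ]]
    exact hf _
  have hB : s.eval b f = MvPolynomial.aeval n P := by
    have hφ : χ.comp (MvPolynomial.aeval n) = MvPolynomial.aeval (fun _ : ℕ => (0 : F)) :=
      MvPolynomial.algHom_ext fun i => by simp [hχn]
    rw [hP, ← s.eval_comp τ (MvPolynomial.aeval n) fun p => by
      rw [hs, ← AlgHom.comp_apply, hφ]
      simp [τ]]
    congr 1
    congr 1
    funext i
    simp [hn]
  -- Substituting e_i r x for the variables gives the sum of r^j P_j(e) x^j; separating powers of r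
  -- leaves P_d(e) x^d = 0, so P_d vanishes at every point e.
  have hcomp : ∀ d, (∃ x, φ x = 0 ∧ x ^ d ≠ 0) → MvPolynomial.homogeneousComponent d P = 0 := by
    rintro d ⟨x, hx, hxd⟩
    apply MvPolynomial.funext
    intro e
    rw [map_zero]
    by_cases hd : d ∈ Finset.range (P.totalDegree + 1)
    swap
    · rw [MvPolynomial.homogeneousComponent_eq_zero _ _ (by simpa using hd), map_zero]
    have h1 := eq_zero_of_sum_pow_smul_eq_zero (F := F) (Finset.range (P.totalDegree + 1))
      (fun j => MvPolynomial.eval e (MvPolynomial.homogeneousComponent j P) • x ^ j) (fun r => by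
        have h2 := hA (fun i => e i • (r • x)) (fun i => by simp [hx])
        rw [← MvPolynomial.sum_homogeneousComponent P, map_sum] at h2
        rw [← h2]
        refine Finset.sum_congr rfl fun j _ => ?_
        rw [aeval_smul_of_isHomogeneous (MvPolynomial.homogeneousComponent_isHomogeneous j P),
          smul_pow, smul_comm]) d hd
    exact (smul_eq_zero.1 h1).resolve_right hxd
  rw [hB, MvPolynomial.aeval_def, MvPolynomial.eval₂_eq]
  refine Finset.sum_eq_zero fun m hm => ?_
  -- A monomial surviving in P has a degree at which all powers vanish on ker φ, hence on ker χ;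
  -- polarisation then kills its value at the n_i.
  have hzero : ∀ x, χ x = 0 → x ^ m.degree = 0 := by
    apply h
    intro x hx
    by_contra hxd
    have := hcomp _ ⟨x, hx, hxd⟩
    have h3 := congrArg (MvPolynomial.coeff m) this
    rw [MvPolynomial.coeff_homogeneousComponent, if_pos rfl] at h3
    exact MvPolynomial.mem_support_iff.1 hm (by simpa using h3)
  have hprod := prod_mul_eq_zero_of_forall_pow_mul_eq_zero (F := F)
    (LinearMap.ker χ.toLinearMap) m.degree 1 (fun x hx => by rw [mul_one]; exact hzero x hx)
    (m.toMultiset.map n) (by rw [Multiset.card_map, Finsupp.card_toMultiset]; rfl)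
    (fun y hy => by
      obtain ⟨i, _, rfl⟩ := Multiset.mem_map.1 hy
      exact hχn i)
  rw [mul_one, Finsupp.toMultiset_map, Finsupp.prod_toMultiset,
    Finsupp.prod_mapDomain_index (by simp) (by simp [pow_add])] at hprod
  exact mul_eq_zero_of_right _ hprod

theorem AlgTrace.identities_subset_of_character [CharZero F] [Ring A] [Algebra F A]
    [Ring B] [Algebra F B] (hA : ∀ x y : A, x * y = y * x) (hB : ∀ x y : B, x * y = y * x)
    (t : AlgTrace F A) (s : AlgTrace F B) (φ : A →ₐ[F] F)
    (χ : B →ₐ[F] F) (δ : F) (ht : ∀ x, t.toLinearMap x = δ * φ x)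
    (hs : ∀ x, s.toLinearMap x = δ * χ x)
    (h : ∀ d, (∀ x, φ x = 0 → x ^ d = 0) → ∀ x, χ x = 0 → x ^ d = 0) :
    t.identities ⊆ s.identities := by
  let _ : CommRing A := { ‹Ring A› with mul_comm := hA }
  let _ : CommRing B := { ‹Ring B› with mul_comm := hB }
  exact AlgTrace.identities_subset_of_character_aux t s φ χ δ ht hs h

/-- All nonzero commutative algebras with zero trace satisfy the same identities. -/
theorem AlgTrace.identities_subset_of_zero_aux [CharZero F] [CommRing A] [Nontrivial A]
    [Algebra F A] [CommRing B] [Algebra F B] (t : AlgTrace F A) (s : AlgTrace F B)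
    (ht : ∀ x, t.toLinearMap x = 0) (hs : ∀ x, s.toLinearMap x = 0) :
    t.identities ⊆ s.identities := by
  intro f hf b
  -- The scalars of A already suffice: with zero trace, f becomes an ordinary polynomial that
  -- vanishes on all points over F.
  have hP : endoEval (0 : MvPolynomial ℕ F →ₗ[F] MvPolynomial ℕ F)
      (fun i => (MvPolynomial.X i : MvPolynomial ℕ F)) f = 0 := by
    apply MvPolynomial.funext
    intro c
    apply (algebraMap F A).injective
    have h1 := t.eval_comp (0 : MvPolynomial ℕ F →ₗ[F] MvPolynomial ℕ F) ((Algebra.ofId F A).comp (MvPolynomial.aeval c))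
      (fun p => by simp [ht]) (fun i => (MvPolynomial.X i : MvPolynomial ℕ F)) f
    rw [show t.eval _ f = 0 from hf _] at h1
    rw [map_zero, map_zero, h1, AlgHom.comp_apply, Algebra.ofId_apply,
      ← MvPolynomial.coe_aeval_eq_eval]
    rfl
  have h2 := s.eval_comp (0 : MvPolynomial ℕ F →ₗ[F] MvPolynomial ℕ F) (MvPolynomial.aeval b)
    (fun p => by simp [hs]) (fun i => (MvPolynomial.X i : MvPolynomial ℕ F)) f
  rw [hP, map_zero] at h2
  simpa using h2

theorem AlgTrace.identities_subset_of_zero [CharZero F] [Ring A] [Nontrivial A]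
    [Algebra F A] [Ring B] [Algebra F B] (hA : ∀ x y : A, x * y = y * x)
    (hB : ∀ x y : B, x * y = y * x) (t : AlgTrace F A) (s : AlgTrace F B)
    (ht : ∀ x, t.toLinearMap x = 0) (hs : ∀ x, s.toLinearMap x = 0) :
    t.identities ⊆ s.identities := by
  let _ : CommRing A := { ‹Ring A› with mul_comm := hA }
  let _ : CommRing B := { ‹Ring B› with mul_comm := hB }
  exact AlgTrace.identities_subset_of_zero_aux t s ht hs

/-- A linear functional `φ` such that all `x - φ x` are nilpotent is a character. -/
theorem exists_algHom_of_isNilpotent_sub [CommRing A] [Nontrivial A] [Algebra F A]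
    (φ : A →ₗ[F] F) (h : ∀ x, IsNilpotent (x - algebraMap F A (φ x))) :
    ∃ χ : A →ₐ[F] F, ∀ x, χ x = φ x := by
  -- Uniqueness of the scalar c with x - c nilpotent makes φ multiplicative, because the nilpotents
  -- form an ideal.
  have huniq : ∀ (x : A) (c : F), IsNilpotent (x - algebraMap F A c) → φ x = c := by
    intro x c hc
    have h1 : IsNilpotent (algebraMap F A (φ x - c)) := by
      rw [show algebraMap F A (φ x - c) =
        (x - algebraMap F A c) - (x - algebraMap F A (φ x)) by rw [map_sub]; ring]
      exact (Commute.all _ _).isNilpotent_sub hc (h x)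
    have h2 : IsNilpotent (φ x - c) :=
      (IsNilpotent.map_iff (algebraMap F A).injective).1 h1
    exact sub_eq_zero.1 h2.eq_zero
  refine ⟨AlgHom.ofLinearMap φ (huniq _ _ (by simp)) fun x y => huniq _ _ ?_, fun x => rfl⟩
  rw [show x * y - algebraMap F A (φ x * φ y) = x * (y - algebraMap F A (φ y)) +
    algebraMap F A (φ y) * (x - algebraMap F A (φ x)) by rw [map_mul]; ring]
  exact (Commute.all _ _).isNilpotent_add ((Commute.all _ _).isNilpotent_mul_left (h y))
    ((Commute.all _ _).isNilpotent_mul_left (h x))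

end Characters

/-! ### The algebras C_k and the nil index of their diagonal character -/

section Toeplitz

variable {F : Type u} [Field F]

theorem toeplitz_apply_eq_zero {k : ℕ} (M : toeplitzAlgebra F k) {i j : Fin k} (h : j < i) :
    M.1 i j = 0 := by
  obtain ⟨M, c, hc⟩ := M
  change M i j = 0
  rw [hc, if_neg (not_le.2 h)]

/-- The diagonal entry, as a character of `C_k`. -/
def toeplitzCharacter (F : Type u) [Field F] (k : ℕ) [NeZero k] : toeplitzAlgebra F k →ₐ[F] F :=
  AlgHom.ofLinearMap
    { toFun := fun M => M.1 0 0
      map_add' := fun _ _ => rfl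
      map_smul' := fun _ _ => rfl }
    (by change (1 : Matrix (Fin k) (Fin k) F) 0 0 = 1; simp)
    (fun M N => by
      change (M.1 * N.1) 0 0 = M.1 0 0 * N.1 0 0
      rw [Matrix.mul_apply, Finset.sum_eq_single 0]
      · intro l _ hl
        rw [toeplitz_apply_eq_zero N (Fin.pos_iff_ne_zero.2 hl), mul_zero]
      · simp)

theorem toeplitzCharacter_apply {k : ℕ} [NeZero k] (M : toeplitzAlgebra F k) :
    toeplitzCharacter F k M = M.1 0 0 := rfl

theorem toeplitz_pow_apply_eq_zero {k : ℕ} [NeZero k] (M : toeplitzAlgebra F k)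
    (hM : M.1 0 0 = 0) (d : ℕ) :
    ∀ i j : Fin k, (j : ℕ) < i + d → (M.1 ^ d) i j = 0 := by
  have h1 : ∀ i j : Fin k, (j : ℕ) < i + 1 → M.1 i j = 0 := by
    intro i j hij
    obtain ⟨M, c, hc⟩ := M
    change M i j = 0
    change M 0 0 = 0 at hM
    rw [hc] at hM ⊢
    split_ifs with hle
    · have : (i : ℕ) ≤ j := hle
      rw [show (j : ℕ) - i = 0 by omega]
      simpa using hM
    · rfl
  induction d with
  | zero =>
    intro i j hij
    rw [pow_zero, Matrix.one_apply_ne]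
    rintro rfl
    omega
  | succ d ih =>
    intro i j hij
    rw [pow_succ, Matrix.mul_apply]
    refine Finset.sum_eq_zero fun l _ => ?_
    by_cases hl : (l : ℕ) < i + d
    · rw [ih i l hl, zero_mul]
    · rw [h1 l j (by omega), mul_zero]

/-- The nilpotent generator of `C_k`. -/
def toeplitzShift (F : Type u) [Field F] (k : ℕ) : toeplitzAlgebra F k :=
  ⟨fun i j => if (j : ℕ) = i + 1 then 1 else 0, fun m => if m = 1 then 1 else 0, fun i j => by
    by_cases h : i ≤ j
    · have h' : (i : ℕ) ≤ j := h
      rw [if_pos h]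
      exact if_congr (by omega) rfl rfl
    · have h' : ¬ (i : ℕ) ≤ j := h
      rw [if_neg h]
      exact if_neg (by omega)⟩

theorem toeplitzShift_pow_apply (k d : ℕ) :
    ∀ i j : Fin k, ((toeplitzShift F k).1 ^ d) i j = if (j : ℕ) = i + d then 1 else 0 := by
  induction d with
  | zero =>
    intro i j
    rw [pow_zero, Matrix.one_apply]
    exact if_congr (by rw [Fin.ext_iff]; omega) rfl rfl
  | succ d ih =>
    intro i j
    rw [pow_succ, Matrix.mul_apply]
    simp only [ih]
    have hs : ∀ l j : Fin k, (toeplitzShift F k).1 l j = if (j : ℕ) = l + 1 then 1 else 0 :=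
      fun _ _ => rfl
    simp only [hs]
    split_ifs with h
    · rw [Finset.sum_eq_single (⟨i + d, by omega⟩ : Fin k)]
      · rw [if_pos rfl, if_pos (by simp; omega), mul_one]
      · intro l _ hl
        rw [if_neg (fun h' => hl (Fin.ext h')), zero_mul]
      · simp
    · refine Finset.sum_eq_zero fun l _ => ?_
      by_cases h1 : (l : ℕ) = i + d
      · rw [if_neg (by omega : ¬ (j : ℕ) = l + 1), mul_zero]
      · rw [if_neg h1, zero_mul]

/-- Each multiplication by a matrix with zero diagonal moves the support one diagonal up, and the
shift shows that nothing vanishes earlier: its d-th power has entry 1 at (0, d) when d < k. -/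
theorem toeplitz_pow_eq_zero_iff (k : ℕ) [NeZero k] (d : ℕ) :
    (∀ x, toeplitzCharacter F k x = 0 → x ^ d = 0) ↔ k ≤ d := by
  constructor
  · intro h
    by_contra hd
    rcases Nat.eq_zero_or_pos d with rfl | hpos
    · have := congrArg (toeplitzCharacter F k) (h 0 (map_zero _))
      simp at this
    have h0 : toeplitzCharacter F k (toeplitzShift F k) = 0 := by
      rw [toeplitzCharacter_apply]
      change (if ((0 : Fin k) : ℕ) = ((0 : Fin k) : ℕ) + 1 then (1 : F) else 0) = 0
      simp
    have h1 := congrArg (fun M : toeplitzAlgebra F k => M.1 0 ⟨d, by omega⟩) (h _ h0)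
    change ((toeplitzShift F k).1 ^ d) 0 ⟨d, by omega⟩ = 0 at h1
    rw [toeplitzShift_pow_apply] at h1
    simp at h1
  · intro h x hx
    refine Subtype.ext (Matrix.ext fun i j => ?_)
    exact toeplitz_pow_apply_eq_zero x hx d i j (by omega)

/-- A commutative algebra whose trace is `δ φ` for a character `φ` with nil kernel of bounded
index is equivalent to some `C_k` with trace `t_{δ,0}`. -/
theorem AlgTrace.exists_tEquiv_toeplitz [CharZero F] {A : Type v} [CommRing A] [Algebra F A]
    (t : AlgTrace F A) (φ : A →ₐ[F] F) (δ : F) (ht : ∀ x, t.toLinearMap x = δ * φ x)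
    (h : ∃ d, ∀ x, φ x = 0 → x ^ d = 0) :
    ∃ (k : ℕ) (_ : NeZero k), t.TEquiv (toeplitzTrace k (t.toLinearMap 1)) := by
  classical
  have hk := Nat.find_spec h
  have hmin : ∀ d, (∀ x, φ x = 0 → x ^ d = 0) ↔ Nat.find h ≤ d := fun d =>
    ⟨fun hd => Nat.find_min' h hd, fun hd x hx => pow_eq_zero_of_le hd (hk x hx)⟩
  -- The least exponent is positive because x^0 = 1 is not zero: φ(1) = 1. It is the size k.
  have _ : NeZero (Nat.find h) := ⟨fun h0 => by
    rw [h0] at hk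
    have := congrArg φ (hk 0 (map_zero _))
    simp at this⟩
  have h1 : t.toLinearMap 1 = δ := by rw [ht, map_one, mul_one]
  refine ⟨Nat.find h, inferInstance, ?_⟩
  rw [h1]
  refine Set.Subset.antisymm ?_ ?_
  · exact AlgTrace.identities_subset_of_character (A := A) (B := toeplitzAlgebra F (Nat.find h))
      mul_comm toeplitzAlgebra_comm t (toeplitzTrace _ δ) φ
      (toeplitzCharacter F _) δ ht (fun _ => rfl) fun d hd =>
        (toeplitz_pow_eq_zero_iff _ d).2 ((hmin d).1 hd)
  · exact AlgTrace.identities_subset_of_character (A := toeplitzAlgebra F (Nat.find h)) (B := A)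
      toeplitzAlgebra_comm mul_comm (toeplitzTrace _ δ) t
      (toeplitzCharacter F _) φ δ (fun _ => rfl) ht fun d hd =>
        (hmin d).2 ((toeplitz_pow_eq_zero_iff _ d).1 hd)

theorem AlgTrace.exists_tEquiv_toeplitz_of_zero [CharZero F] {A : Type v} [CommRing A]
    [Nontrivial A] [Algebra F A] (t : AlgTrace F A) (ht : ∀ x, t.toLinearMap x = 0) :
    ∃ (k : ℕ) (_ : NeZero k), t.TEquiv (toeplitzTrace k (t.toLinearMap 1)) := by
  have _ : Nontrivial (toeplitzAlgebra F 1) := (toeplitzCharacter F 1).toRingHom.domain_nontrivial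
  -- With zero trace all sizes give the same identities, so k = 1 is as good as any.
  refine ⟨1, inferInstance, Set.Subset.antisymm ?_ ?_⟩
  · exact AlgTrace.identities_subset_of_zero (A := A) (B := toeplitzAlgebra F 1)
      mul_comm toeplitzAlgebra_comm t (toeplitzTrace 1 _) ht
      fun x => by rw [ht]; exact zero_mul _
  · exact AlgTrace.identities_subset_of_zero (A := toeplitzAlgebra F 1) (B := A)
      toeplitzAlgebra_comm mul_comm (toeplitzTrace 1 _) t
      (fun x => by rw [ht]; exact zero_mul _) ht

/-- The case of an algebra all of whose elements are scalars. -/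
theorem AlgTrace.exists_tEquiv_toeplitz_of_scalar [CharZero F] {A : Type v} [CommRing A]
    [Nontrivial A] [Algebra F A] (t : AlgTrace F A) (h : ∀ x : A, ∃ c, x = algebraMap F A c) :
    ∃ (k : ℕ) (_ : NeZero k), t.TEquiv (toeplitzTrace k (t.toLinearMap 1)) := by
  have hb : Function.Bijective (algebraMap F A) :=
    ⟨(algebraMap F A).injective, fun x => (h x).imp fun _ hc => hc.symm⟩
  let e : F ≃ₐ[F] A := AlgEquiv.ofBijective (Algebra.ofId F A) hb
  refine t.exists_tEquiv_toeplitz e.symm.toAlgHom (t.toLinearMap 1) (fun x => ?_)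
    ⟨1, fun x hx => ?_⟩
  · obtain ⟨c, rfl⟩ := h x
    rw [Algebra.algebraMap_eq_smul_one, map_smul]
    simp [mul_comm]
  · rw [pow_one]
    exact e.symm.injective (hx.trans (map_zero _).symm)

end Toeplitz

/-! ### Coordinates on D_2 -/

section Diagonal

variable {F : Type u} [Field F]

theorem diagonalAlgebra_comm {n : ℕ} (a b : diagonalAlgebra F n) : a * b = b * a := by
  obtain ⟨_, a, rfl⟩ := a
  obtain ⟨_, b, rfl⟩ := b
  refine Subtype.ext ?_
  change Matrix.diagonalAlgHom F a * Matrix.diagonalAlgHom F b =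
    Matrix.diagonalAlgHom F b * Matrix.diagonalAlgHom F a
  rw [← map_mul, ← map_mul, mul_comm]

/-- The `i`-th diagonal entry, as a character of `D_n`. -/
def diagonalCharacter (F : Type u) [Field F] {n : ℕ} (i : Fin n) : diagonalAlgebra F n →ₐ[F] F :=
  AlgHom.ofLinearMap
    { toFun := fun M => M.1 i i
      map_add' := fun _ _ => rfl
      map_smul' := fun _ _ => rfl }
    (by change (1 : Matrix (Fin n) (Fin n) F) i i = 1; simp)
    (by
      rintro ⟨_, a, rfl⟩ ⟨_, b, rfl⟩
      change (Matrix.diagonal a * Matrix.diagonal b) i i =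
        Matrix.diagonal a i i * Matrix.diagonal b i i
      simp)

theorem diagonalAlgebra_ext {n : ℕ} {a b : diagonalAlgebra F n}
    (h : ∀ i, diagonalCharacter F i a = diagonalCharacter F i b) : a = b := by
  obtain ⟨_, a, rfl⟩ := a
  obtain ⟨_, b, rfl⟩ := b
  have : a = b := by
    funext i
    have := h i
    change Matrix.diagonal a i i = Matrix.diagonal b i i at this
    simpa using this
  rw [this]

theorem exists_diagonalCharacter_eq {n : ℕ} (a : Fin n → F) :
    ∃ x : diagonalAlgebra F n, ∀ i, diagonalCharacter F i x = a i :=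
  ⟨⟨_, a, rfl⟩, fun i => by
    change Matrix.diagonal a i i = a i
    simp⟩

theorem diagonalTrace_apply (α β : F) (x : diagonalAlgebra F 2) :
    (diagonalTrace ![α, β]).toLinearMap x =
      α * diagonalCharacter F 0 x + β * diagonalCharacter F 1 x := by
  change ∑ i : Fin 2, ![α, β] i * x.1 i i = α * x.1 0 0 + β * x.1 1 1
  simp [Fin.sum_univ_two]

/-- A trace polynomial is an identity of `D_2` as soon as it vanishes under both characters. -/
theorem mem_identities_diagonal {α β : F} {f : TracePoly F}
    (h : ∀ a i, diagonalCharacter F i ((diagonalTrace ![α, β]).eval a f) = 0) :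
    f ∈ (diagonalTrace ![α, β]).identities := fun a =>
  diagonalAlgebra_ext fun i => by rw [h, map_zero]

end Diagonal

/-! ### Coordinates on C_2 -/

section Strange

variable {F : Type u} [Field F]

/-- The entry above the diagonal of an element of `C_2`. -/
def toeplitzEntry (x : toeplitzAlgebra F 2) : F := x.1 0 1

theorem toeplitz_two_ext {x y : toeplitzAlgebra F 2}
    (h₀ : toeplitzCharacter F 2 x = toeplitzCharacter F 2 y)
    (h₁ : toeplitzEntry x = toeplitzEntry y) : x = y := by
  obtain ⟨M, c, hc⟩ := x
  obtain ⟨N, d, hd⟩ := y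
  change M 0 0 = N 0 0 at h₀
  change M 0 1 = N 0 1 at h₁
  refine Subtype.ext (Matrix.ext fun i j => ?_)
  change M i j = N i j
  have e₀ : M 1 1 = M 0 0 := by rw [hc, hc]; rfl
  have e₁ : N 1 1 = N 0 0 := by rw [hd, hd]; rfl
  have e₂ : M 1 0 = N 1 0 := by rw [hc, hd]; rfl
  fin_cases i <;> fin_cases j
  · exact h₀
  · exact h₁
  · exact e₂
  · exact e₀.trans (h₀.trans e₁.symm)

@[simp]
theorem toeplitzEntry_mul (x y : toeplitzAlgebra F 2) : toeplitzEntry (x * y) =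
    toeplitzCharacter F 2 x * toeplitzEntry y + toeplitzEntry x * toeplitzCharacter F 2 y := by
  obtain ⟨N, d, hd⟩ := y
  change (x.1 * N) 0 1 = x.1 0 0 * N 0 1 + x.1 0 1 * N 0 0
  have e₁ : N 1 1 = N 0 0 := by rw [hd, hd]; rfl
  rw [Matrix.mul_apply, Fin.sum_univ_two, e₁]

@[simp]
theorem toeplitzEntry_add (x y : toeplitzAlgebra F 2) :
    toeplitzEntry (x + y) = toeplitzEntry x + toeplitzEntry y := rfl

@[simp]
theorem toeplitzEntry_sub (x y : toeplitzAlgebra F 2) :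
    toeplitzEntry (x - y) = toeplitzEntry x - toeplitzEntry y := rfl

@[simp]
theorem toeplitzEntry_smul (c : F) (x : toeplitzAlgebra F 2) :
    toeplitzEntry (c • x) = c * toeplitzEntry x := rfl

@[simp]
theorem toeplitzEntry_zero : toeplitzEntry (0 : toeplitzAlgebra F 2) = 0 := rfl

@[simp]
theorem toeplitzEntry_algebraMap (c : F) :
    toeplitzEntry (algebraMap F (toeplitzAlgebra F 2) c) = 0 := by
  change algebraMap F (Matrix (Fin 2) (Fin 2) F) c 0 1 = 0
  simp [Matrix.algebraMap_matrix_apply]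

theorem strangeTrace_apply (α β : F) (x : toeplitzAlgebra F 2) :
    (strangeTrace α β).toLinearMap x = α * toeplitzCharacter F 2 x + β * toeplitzEntry x := rfl

end Strange

/-! ### Commutativity passes to the variety -/

section Commutativity

variable {F : Type u} [Field F] {A : Type v} {B : Type w} [Ring A] [Algebra F A] [Ring B]
  [Algebra F B]

theorem AlgTrace.MemVariety.mul_comm {t : AlgTrace F A} {s : AlgTrace F B} (h : t.MemVariety s)
    (hB : ∀ x y : B, x * y = y * x) (x y : A) : x * y = y * x := by
  have h1 : varPoly F 0 * varPoly F 1 - varPoly F 1 * varPoly F 0 ∈ s.identities := fun b => by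
    simp [hB (b 0)]
  have h2 := h h1 fun i => if i = 0 then x else y
  simpa [sub_eq_zero] using h2

end Commutativity

/-! ### The variety of D_2 with trace weights δ, 0 -/

section SemisimpleDegenerate

variable {F : Type u} [Field F] [CharZero F] {A : Type v} [CommRing A] [Nontrivial A]
  [Algebra F A]

theorem AlgTrace.tEquiv_diagonal_zero_or (t : AlgTrace F A) (δ : F) (hδ : δ ≠ 0)
    (h : t.MemVariety (diagonalTrace ![δ, 0])) :
    t.TEquiv (diagonalTrace ![δ, 0]) ∨
      ∃ (k : ℕ) (_ : NeZero k), t.TEquiv (toeplitzTrace k (t.toLinearMap 1)) := by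
  -- On D_2 this trace is δ times the first coordinate, so δ⁻¹ tr is multiplicative there, and the
  -- identity transfers this to A.
  have hmul : ∀ x y, t.toLinearMap x * t.toLinearMap y = δ * t.toLinearMap (x * y) := by
    intro x y
    have h1 : tracePoly F 0 [] * tracePoly F 1 [] - δ • tracePoly F 0 [1] ∈
        (diagonalTrace ![δ, 0]).identities := mem_identities_diagonal fun a i => by
      simp [diagonalTrace_apply]
      ring
    have h2 := h h1 fun i => if i = 0 then x else y
    apply (algebraMap F A).injective
    rw [map_mul, map_mul]
    simpa [sub_eq_zero, Algebra.smul_def] using h2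
  by_cases h0 : ∀ x, t.toLinearMap x = 0
  · exact Or.inr (t.exists_tEquiv_toeplitz_of_zero h0)
  push Not at h0
  obtain ⟨x₀, hx₀⟩ := h0
  have h1 : t.toLinearMap 1 = δ := by
    have := hmul x₀ 1
    rw [mul_one, mul_comm δ] at this
    exact mul_left_cancel₀ hx₀ this
  let φ : A →ₐ[F] F := AlgHom.ofLinearMap (δ⁻¹ • t.toLinearMap) (by simp [h1, hδ]) fun x y => by
    have := hmul x y
    simp only [LinearMap.smul_apply, smul_eq_mul]
    field_simp
    rw [this]
  have ht : ∀ x, t.toLinearMap x = δ * φ x := fun x => by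
    change _ = δ * (δ⁻¹ * t.toLinearMap x)
    field_simp
  by_cases hn : ∃ d, ∀ x, φ x = 0 → x ^ d = 0
  · exact Or.inr (t.exists_tEquiv_toeplitz φ δ ht hn)
  -- If no power d vanishes on ker φ, the comparison of nil exponents is vacuous.
  · refine Or.inl (Set.Subset.antisymm ?_ h)
    exact AlgTrace.identities_subset_of_character (A := A) (B := diagonalAlgebra F 2)
      _root_.mul_comm diagonalAlgebra_comm t (diagonalTrace ![δ, 0]) φ (diagonalCharacter F 0) δ ht
      (fun x => by simp [diagonalTrace_apply]) fun d hd => absurd ⟨d, hd⟩ hn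

end SemisimpleDegenerate

/-! ### Identities of C_2 with the strange trace -/

section StrangeIdentities

variable {F : Type u} [Field F] {A : Type v} [CommRing A] [Algebra F A]

/-- Write q for the expression inside the square. At x = a + b n with n² = 0, the scalar parts
cancel and q = -2b² n, so q² = 0. -/
theorem AlgTrace.MemVariety.strange_sq {t : AlgTrace F A} {ε : F}
    (h : t.MemVariety (strangeTrace ε 1)) (x : A) :
    (ε • x ^ 2 - (2 * t.toLinearMap x) • x + algebraMap F A (t.toLinearMap (x ^ 2))) ^ 2 = 0 := by
  have h1 : (ε • varPoly F 0 ^ 2 - 2 * tracePoly F 0 [] * varPoly F 0 + tracePoly F 0 [0]) ^ 2 ∈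
      (strangeTrace ε 1).identities := fun a => by
    apply toeplitz_two_ext <;>
    · simp [strangeTrace_apply, pow_two, two_mul]
      try ring
  have h2 := h h1 fun _ => x
  simpa [Algebra.smul_def, two_mul, pow_two x] using h2

/-- With q = -2b² n as in `AlgTrace.MemVariety.strange_sq`, tr(q y) is -2b² times the diagonal entry
of y, while tr(x)² - ε tr(x²) = b². The expression is therefore 2b² times y minus its diagonal
entry, which squares to zero. -/
theorem AlgTrace.MemVariety.strange_sub_sq {t : AlgTrace F A} {ε : F}
    (h : t.MemVariety (strangeTrace ε 1)) (x y : A) :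
    ((2 * (t.toLinearMap x ^ 2 - ε * t.toLinearMap (x ^ 2))) • y + algebraMap F A
      (ε * t.toLinearMap (x ^ 2 * y) - 2 * t.toLinearMap x * t.toLinearMap (x * y) +
        t.toLinearMap (x ^ 2) * t.toLinearMap y)) ^ 2 = 0 := by
  have h1 : (2 * (tracePoly F 0 [] ^ 2 - ε • tracePoly F 0 [0]) * varPoly F 1 +
      (ε • tracePoly F 0 [0, 1] - 2 * tracePoly F 0 [] * tracePoly F 0 [1] +
        tracePoly F 0 [0] * tracePoly F 1 [])) ^ 2 ∈ (strangeTrace ε 1).identities := fun a => by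
    apply toeplitz_two_ext <;>
    · simp [strangeTrace_apply, pow_two, two_mul]
      try ring
  have h2 := h h1 fun i => if i = 0 then x else y
  simpa [Algebra.smul_def, two_mul, pow_two x, mul_assoc] using h2

end StrangeIdentities

/-! ### The variety of C_2 with the strange trace -/

section StrangeVariety

variable {F : Type u} [Field F] [CharZero F] {A : Type v} [CommRing A] [Nontrivial A]
  [Algebra F A]

theorem AlgTrace.tEquiv_strange_or (t : AlgTrace F A) (ε : F)
    (h : t.MemVariety (strangeTrace ε 1)) :
    t.TEquiv (strangeTrace ε 1) ∨
      ∃ (k : ℕ) (_ : NeZero k), t.TEquiv (toeplitzTrace k (t.toLinearMap 1)) := by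
  have h1 : t.toLinearMap 1 = ε := by
    have := h.strange_sq 1
    rw [one_pow, ← Algebra.algebraMap_eq_smul_one, ← Algebra.algebraMap_eq_smul_one, ← map_sub,
      ← map_add, ← map_pow, map_eq_zero] at this
    have := pow_eq_zero_iff (two_ne_zero) |>.1 this
    linear_combination -this
  by_cases hΔ : ∃ x, t.toLinearMap x ^ 2 - ε * t.toLinearMap (x ^ 2) ≠ 0
  · obtain ⟨x, hx⟩ := hΔ
    set D := t.toLinearMap x ^ 2 - ε * t.toLinearMap (x ^ 2) with hD
    -- This recovers the diagonal entry of y from traces: it is -tr(q y)/(2D).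
    let φ : A →ₗ[F] F := (-(2 * D)⁻¹) • (ε • t.toLinearMap.comp (LinearMap.mulLeft F (x ^ 2)) -
      (2 * t.toLinearMap x) • t.toLinearMap.comp (LinearMap.mulLeft F x) +
        t.toLinearMap (x ^ 2) • t.toLinearMap)
    have hφ : ∀ y, (y - algebraMap F A (φ y)) ^ 2 = 0 := by
      intro y
      have h2 := h.strange_sub_sq x y
      rw [← hD] at h2
      have h3 : (2 * D) • (y - algebraMap F A (φ y)) = (2 * D) • y + algebraMap F A
          (ε * t.toLinearMap (x ^ 2 * y) - 2 * t.toLinearMap x * t.toLinearMap (x * y) +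
        t.toLinearMap (x ^ 2) * t.toLinearMap y) := by
        rw [smul_sub, sub_eq_add_neg, Algebra.smul_def _ (algebraMap F A _), ← map_mul, ← map_neg]
        congr 2
        simp [φ]
        field_simp
        ring
      rw [← h3, smul_pow] at h2
      exact (smul_eq_zero.1 h2).resolve_left (by simp [hx])
    obtain ⟨χ, hχ⟩ := exists_algHom_of_isNilpotent_sub φ fun y => ⟨2, hφ y⟩
    have hsq : ∀ n, χ n = 0 → n ^ 2 = 0 := by
      intro n hn
      have := hφ n
      rwa [← hχ, hn, map_zero, sub_zero] at this
    by_cases hn : ∃ n, χ n = 0 ∧ t.toLinearMap n ≠ 0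
    · left
      obtain ⟨n₀, hn₀, htn₀⟩ := hn
      set n := (t.toLinearMap n₀)⁻¹ • n₀ with hn
      have hχn : χ n = 0 := by simp [hn, hn₀]
      have htn : t.toLinearMap n = 1 := by simp [hn, htn₀]
      have hnn : n * n = 0 := by rw [← pow_two]; exact hsq n hχn
      -- A square-zero n with tr(n) = 1 plays the role of the matrix unit above the diagonal.
      let ψ : toeplitzAlgebra F 2 →ₐ[F] A := AlgHom.ofLinearMap
        { toFun := fun x => algebraMap F A (toeplitzCharacter F 2 x) + toeplitzEntry x • n
          map_add' := fun x y => by simp [add_smul]; ring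
          map_smul' := fun c x => by simp [Algebra.smul_def, mul_add, mul_assoc] }
        (by
          have : toeplitzEntry (1 : toeplitzAlgebra F 2) = 0 := by
            rw [← map_one (algebraMap F _), toeplitzEntry_algebraMap]
          simp [this])
        (fun x y => by
          simp only [LinearMap.coe_mk, AddHom.coe_mk, toeplitzEntry_mul, map_mul, map_add,
            Algebra.smul_def]
          linear_combination (-(algebraMap F A (toeplitzEntry x) *
            algebraMap F A (toeplitzEntry y))) * hnn)
      have hψ : ∀ x, ψ x = algebraMap F A (toeplitzCharacter F 2 x) + toeplitzEntry x • n :=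
        fun _ => rfl
      have htψ : ∀ x, t.toLinearMap (ψ x) = (strangeTrace ε 1).toLinearMap x := by
        intro x
        rw [hψ, strangeTrace_apply, Algebra.algebraMap_eq_smul_one, map_add, map_smul, map_smul,
          h1, htn]
        simp [_root_.mul_comm]
      refine Set.Subset.antisymm (t.identities_subset_of_injective _ ψ ?_ htψ) h
      rw [injective_iff_map_eq_zero]
      intro x hx
      have e₁ : toeplitzCharacter F 2 x = 0 := by
        have := congrArg χ hx
        simpa [hψ, hχn] using this
      refine toeplitz_two_ext (by simpa using e₁) ?_
      have := congrArg t.toLinearMap hx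
      rw [htψ, strangeTrace_apply, e₁] at this
      simpa using this
    · right
      push Not at hn
      refine t.exists_tEquiv_toeplitz χ (t.toLinearMap 1) (fun y => ?_) ⟨2, hsq⟩
      have := hn (y - algebraMap F A (χ y)) (by simp)
      rw [map_sub, Algebra.algebraMap_eq_smul_one, map_smul, smul_eq_mul, sub_eq_zero] at this
      rw [this, _root_.mul_comm]
  · right
    push Not at hΔ
    by_cases hε : ε = 0
    · subst hε
      exact t.exists_tEquiv_toeplitz_of_zero fun x => by simpa using hΔ x
    · have hnil : ∀ x, (x - algebraMap F A ((ε⁻¹ • t.toLinearMap) x)) ^ 4 = 0 := by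
        intro x
        have h2 := h.strange_sq x
        -- When the discriminant vanishes and c = tr(x)/ε, tr(x²) = ε c² and q becomes the perfect
        -- square ε(x - c)²; since q² = 0, the fourth power of x - c vanishes.
        have h3 : ε • (x - algebraMap F A ((ε⁻¹ • t.toLinearMap) x)) ^ 2 =
            ε • x ^ 2 - (2 * t.toLinearMap x) • x + algebraMap F A (t.toLinearMap (x ^ 2)) := by
          obtain ⟨c, hc⟩ : ∃ c, c = ε⁻¹ * t.toLinearMap x := ⟨_, rfl⟩
          have h5 : t.toLinearMap x = ε * c := by rw [hc]; field_simp
          have h4 : t.toLinearMap (x ^ 2) = ε * c ^ 2 := by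
            rw [hc]
            field_simp
            linear_combination -hΔ x
          rw [show (ε⁻¹ • t.toLinearMap) x = c from hc.symm, h4, h5]
          simp only [Algebra.smul_def, map_mul, map_pow, map_ofNat]
          ring
        rw [← h3, smul_pow, ← pow_mul] at h2
        exact (smul_eq_zero.1 h2).resolve_left (by simp [hε])
      obtain ⟨χ, hχ⟩ := exists_algHom_of_isNilpotent_sub (ε⁻¹ • t.toLinearMap)
        fun y => ⟨4, hnil y⟩
      refine t.exists_tEquiv_toeplitz χ ε (fun x => ?_) ⟨4, fun x hx => ?_⟩
      · rw [hχ]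
        simp [hε]
      · have := hnil x
        rwa [← hχ, hx, map_zero, sub_zero] at this

end StrangeVariety

/-! ### Identities of D_2: discriminant, third moment and idempotents -/

section DiagonalIdentities

variable {F : Type u} [Field F] {A : Type v} [CommRing A] [Algebra F A]

/-- The discriminant `(α + β) tr(x²) - tr(x)²`, equal to `α β (a - b)²` at `x = diag(a, b)`. -/
def AlgTrace.disc (t : AlgTrace F A) (s : F) (x : A) : F :=
  s * t.toLinearMap (x * x) - t.toLinearMap x ^ 2

/-- The third central moment, equal to `α β (β - α) (a - b)³` at `x = diag(a, b)`. -/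
def AlgTrace.moment (t : AlgTrace F A) (s : F) (x : A) : F :=
  s ^ 2 * t.toLinearMap (x * (x * x)) - 3 * s * t.toLinearMap x * t.toLinearMap (x * x) +
    2 * t.toLinearMap x ^ 3

/-- Equal to `α β (a - b)² (a + b)` at `x = diag(a, b)`. -/
def AlgTrace.discSum (t : AlgTrace F A) (s : F) (x : A) : F :=
  s * t.toLinearMap (x * (x * x)) - t.toLinearMap x * t.toLinearMap (x * x)

noncomputable def discPoly (s : F) : TracePoly F :=
  s • tracePoly F 0 [0] - tracePoly F 0 [] ^ 2

noncomputable def momentPoly (s : F) : TracePoly F :=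
  s ^ 2 • tracePoly F 0 [0, 0] - (3 * s) • (tracePoly F 0 [] * tracePoly F 0 [0]) +
    (2 : F) • tracePoly F 0 [] ^ 3

noncomputable def discSumPoly (s : F) : TracePoly F :=
  s • tracePoly F 0 [0, 0] - tracePoly F 0 [] * tracePoly F 0 [0]

theorem AlgTrace.eval_discPoly (t : AlgTrace F A) (s : F) (a : ℕ → A) :
    t.eval a (discPoly s) = algebraMap F A (t.disc s (a 0)) := by
  simp [discPoly, AlgTrace.disc, Algebra.smul_def]

theorem AlgTrace.eval_momentPoly (t : AlgTrace F A) (s : F) (a : ℕ → A) :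
    t.eval a (momentPoly s) = algebraMap F A (t.moment s (a 0)) := by
  simp [momentPoly, AlgTrace.moment, Algebra.smul_def, mul_assoc]

theorem AlgTrace.eval_discSumPoly (t : AlgTrace F A) (s : F) (a : ℕ → A) :
    t.eval a (discSumPoly s) = algebraMap F A (t.discSum s (a 0)) := by
  simp [discSumPoly, AlgTrace.discSum, Algebra.smul_def]

theorem diagonalCharacter_eval_discPoly (α β : F) (a : ℕ → diagonalAlgebra F 2) (i : Fin 2) :
    diagonalCharacter F i ((diagonalTrace ![α, β]).eval a (discPoly (α + β))) =
      α * β * (diagonalCharacter F 0 (a 0) - diagonalCharacter F 1 (a 0)) ^ 2 := by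
  simp [discPoly, diagonalTrace_apply]
  ring

theorem diagonalCharacter_eval_momentPoly (α β : F) (a : ℕ → diagonalAlgebra F 2) (i : Fin 2) :
    diagonalCharacter F i ((diagonalTrace ![α, β]).eval a (momentPoly (α + β))) =
      α * β * (β - α) * (diagonalCharacter F 0 (a 0) - diagonalCharacter F 1 (a 0)) ^ 3 := by
  simp [momentPoly, diagonalTrace_apply]
  ring

theorem diagonalCharacter_eval_discSumPoly (α β : F) (a : ℕ → diagonalAlgebra F 2) (i : Fin 2) :
    diagonalCharacter F i ((diagonalTrace ![α, β]).eval a (discSumPoly (α + β))) =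
      α * β * (diagonalCharacter F 0 (a 0) - diagonalCharacter F 1 (a 0)) ^ 2 *
        (diagonalCharacter F 0 (a 0) + diagonalCharacter F 1 (a 0)) := by
  simp [discSumPoly, diagonalTrace_apply]
  ring

/-- At diag(a, b) the element u = (α+β)x - tr(x) is (a-b) diag(β, -α). This yields αβ(u² - disc)² =
(α-β)² disc u², which reduces to αβ u⁴ = 0 when disc = 0. -/
theorem AlgTrace.MemVariety.disc_pow_four {t : AlgTrace F A} {α β : F}
    (h : t.MemVariety (diagonalTrace ![α, β])) (x : A) (hx : t.disc (α + β) x = 0) :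
    (α * β) • ((α + β) • x - algebraMap F A (t.toLinearMap x)) ^ 4 = 0 := by
  have h1 : (α * β) • (((α + β) • varPoly F 0 - tracePoly F 0 []) ^ 2 - discPoly (α + β)) ^ 2 -
      (α - β) ^ 2 • (discPoly (α + β) * ((α + β) • varPoly F 0 - tracePoly F 0 []) ^ 2) ∈
      (diagonalTrace ![α, β]).identities := mem_identities_diagonal fun a i => by
    simp only [map_sub, map_smul, map_pow, map_mul, diagonalCharacter_eval_discPoly]
    fin_cases i <;>
    · simp [diagonalTrace_apply]
      ring
  have h2 := h h1 fun _ => x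
  simp only [map_sub, map_smul, map_pow, map_mul, AlgTrace.eval_discPoly, hx, map_zero, sub_zero,
    zero_mul, smul_zero, AlgTrace.eval_varPoly, AlgTrace.eval_tracePoly, List.map_nil,
    List.prod_nil, mul_one, ← pow_mul] at h2
  exact h2

/-- Used for nonvanishing: if α ≠ β, a nonzero discriminant forces a nonzero moment. -/
theorem AlgTrace.MemVariety.moment_sq {t : AlgTrace F A} [Nontrivial A] {α β : F}
    (h : t.MemVariety (diagonalTrace ![α, β])) (x : A) :
    α * β * t.moment (α + β) x ^ 2 = (β - α) ^ 2 * t.disc (α + β) x ^ 3 := by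
  have h1 : (α * β) • momentPoly (α + β) ^ 2 - (β - α) ^ 2 • discPoly (α + β) ^ 3 ∈
      (diagonalTrace ![α, β]).identities := mem_identities_diagonal fun a i => by
    simp only [map_sub, map_smul, map_pow, diagonalCharacter_eval_discPoly,
      diagonalCharacter_eval_momentPoly, smul_eq_mul]
    ring
  have h2 := h h1 fun _ => x
  simp only [map_sub, map_smul, map_pow, AlgTrace.eval_discPoly, AlgTrace.eval_momentPoly,
    Algebra.smul_def] at h2
  apply (algebraMap F A).injective
  simpa [sub_eq_zero] using h2

/-- A multiple of the idempotent `diag(1, 0)`, as a function of `x`. -/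
def AlgTrace.quasiIdem (t : AlgTrace F A) (α β : F) (x : A) : A :=
  algebraMap F A (2 * (β - α) * t.disc (α + β) x) * x -
    algebraMap F A ((β - α) * t.discSum (α + β) x - t.moment (α + β) x)

noncomputable def quasiIdemPoly (α β : F) : TracePoly F :=
  (2 * (β - α)) • (discPoly (α + β) * varPoly F 0) -
    ((β - α) • discSumPoly (α + β) - momentPoly (α + β))

theorem AlgTrace.eval_quasiIdemPoly (t : AlgTrace F A) (α β : F) (a : ℕ → A) :
    t.eval a (quasiIdemPoly α β) = t.quasiIdem α β (a 0) := by
  simp [quasiIdemPoly, AlgTrace.quasiIdem, AlgTrace.eval_discPoly, AlgTrace.eval_discSumPoly,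
    AlgTrace.eval_momentPoly, Algebra.smul_def]
  ring

/-- Factoring out αβ(β-α)(a-b)² leaves 2x - (a+b) + (a-b), which is 2(a-b) in the first coordinate
and 0 in the second. The odd moment supplies the signed difference a-b. -/
theorem diagonalCharacter_eval_quasiIdemPoly (α β : F) (a : ℕ → diagonalAlgebra F 2) (i : Fin 2) :
    diagonalCharacter F i ((diagonalTrace ![α, β]).eval a (quasiIdemPoly α β)) =
      if i = 0 then
        2 * (α * β * (β - α) * (diagonalCharacter F 0 (a 0) - diagonalCharacter F 1 (a 0)) ^ 3)
      else 0 := by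
  simp only [quasiIdemPoly, map_sub, map_smul, map_mul, diagonalCharacter_eval_discPoly,
    diagonalCharacter_eval_discSumPoly, diagonalCharacter_eval_momentPoly, smul_eq_mul,
    AlgTrace.eval_varPoly]
  fin_cases i <;>
  · simp
    ring

/-- The trace of `G y`, where `G` is given by `quasiIdemPoly`. -/
noncomputable def traceQuasiIdemPoly (α β : F) : TracePoly F :=
  (2 * (β - α)) • (discPoly (α + β) * tracePoly F 0 [1]) -
    ((β - α) • discSumPoly (α + β) - momentPoly (α + β)) * tracePoly F 1 []

theorem AlgTrace.eval_traceQuasiIdemPoly (t : AlgTrace F A) (α β : F) (a : ℕ → A) :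
    t.eval a (traceQuasiIdemPoly α β) =
      algebraMap F A (t.toLinearMap (t.quasiIdem α β (a 0) * a 1)) := by
  have : t.toLinearMap (t.quasiIdem α β (a 0) * a 1) =
      2 * (β - α) * t.disc (α + β) (a 0) * t.toLinearMap (a 0 * a 1) -
        ((β - α) * t.discSum (α + β) (a 0) - t.moment (α + β) (a 0)) * t.toLinearMap (a 1) := by
    rw [AlgTrace.quasiIdem, sub_mul, mul_assoc, ← Algebra.smul_def, ← Algebra.smul_def, map_sub,
      map_smul, map_smul, smul_eq_mul, smul_eq_mul]
  rw [this]
  simp [traceQuasiIdemPoly, AlgTrace.eval_discPoly, AlgTrace.eval_discSumPoly,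
    AlgTrace.eval_momentPoly, Algebra.smul_def]
  ring

theorem diagonalCharacter_eval_traceQuasiIdemPoly (α β : F) (a : ℕ → diagonalAlgebra F 2)
    (i : Fin 2) :
    diagonalCharacter F i ((diagonalTrace ![α, β]).eval a (traceQuasiIdemPoly α β)) =
      2 * (α * β * (β - α) * (diagonalCharacter F 0 (a 0) - diagonalCharacter F 1 (a 0)) ^ 3) *
        (α * diagonalCharacter F 0 (a 1)) := by
  simp only [traceQuasiIdemPoly, map_sub, map_smul, map_mul, diagonalCharacter_eval_discPoly,
    diagonalCharacter_eval_discSumPoly, diagonalCharacter_eval_momentPoly, smul_eq_mul]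
  simp [diagonalTrace_apply]
  ring

theorem AlgTrace.MemVariety.quasiIdem_mul_self {t : AlgTrace F A} {α β : F}
    (h : t.MemVariety (diagonalTrace ![α, β])) (x : A) :
    t.quasiIdem α β x * t.quasiIdem α β x = (2 * t.moment (α + β) x) • t.quasiIdem α β x := by
  have h1 : quasiIdemPoly α β * quasiIdemPoly α β -
      (2 : F) • (momentPoly (α + β) * quasiIdemPoly α β) ∈
      (diagonalTrace ![α, β]).identities := mem_identities_diagonal fun a i => by
    simp only [map_sub, map_smul, map_mul, diagonalCharacter_eval_quasiIdemPoly,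
      diagonalCharacter_eval_momentPoly, smul_eq_mul]
    fin_cases i <;>
    · simp
      try ring
  have h2 := h h1 fun _ => x
  simp only [map_sub, map_smul, map_mul, AlgTrace.eval_quasiIdemPoly, AlgTrace.eval_momentPoly,
    ← Algebra.smul_def, smul_smul] at h2
  exact sub_eq_zero.1 h2

/-- In D_2, α e y = tr(e y) e for e = diag(1, 0). Transferred to A, this bounds the dimension of eA
by one. -/
theorem AlgTrace.MemVariety.quasiIdem_mul {t : AlgTrace F A} {α β : F}
    (h : t.MemVariety (diagonalTrace ![α, β])) (x y : A) :
    (α * (2 * t.moment (α + β) x)) • (t.quasiIdem α β x * y) =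
      t.toLinearMap (t.quasiIdem α β x * y) • t.quasiIdem α β x := by
  have h1 : (α * 2) • (momentPoly (α + β) * (quasiIdemPoly α β * varPoly F 1)) -
      traceQuasiIdemPoly α β * quasiIdemPoly α β ∈
      (diagonalTrace ![α, β]).identities := mem_identities_diagonal fun a i => by
    simp only [map_sub, map_smul, map_mul, diagonalCharacter_eval_quasiIdemPoly,
      diagonalCharacter_eval_momentPoly, diagonalCharacter_eval_traceQuasiIdemPoly, smul_eq_mul,
      AlgTrace.eval_varPoly]
    fin_cases i <;>
    · simp
      try ring
  have h2 := h h1 fun i => if i = 0 then x else y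
  simp only [map_sub, map_smul, map_mul, AlgTrace.eval_quasiIdemPoly, AlgTrace.eval_momentPoly,
    AlgTrace.eval_traceQuasiIdemPoly, AlgTrace.eval_varPoly, ← Algebra.smul_def, smul_smul,
    if_true, one_ne_zero, if_false, mul_assoc] at h2
  exact sub_eq_zero.1 h2

/-- The counterpart for the complementary idempotent, whose weight is β. -/
theorem AlgTrace.MemVariety.sub_quasiIdem_mul {t : AlgTrace F A} {α β : F}
    (h : t.MemVariety (diagonalTrace ![α, β])) (x y : A) :
    (β * (2 * t.moment (α + β) x)) •
        ((algebraMap F A (2 * t.moment (α + β) x) - t.quasiIdem α β x) * y) =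
      (2 * t.moment (α + β) x * t.toLinearMap y - t.toLinearMap (t.quasiIdem α β x * y)) •
        (algebraMap F A (2 * t.moment (α + β) x) - t.quasiIdem α β x) := by
  have h1 : (β * 2) • (momentPoly (α + β) *
      (((2 : F) • momentPoly (α + β) - quasiIdemPoly α β) * varPoly F 1)) -
      ((2 : F) • (momentPoly (α + β) * tracePoly F 1 []) - traceQuasiIdemPoly α β) *
        ((2 : F) • momentPoly (α + β) - quasiIdemPoly α β) ∈
      (diagonalTrace ![α, β]).identities := mem_identities_diagonal fun a i => by
    simp only [map_sub, map_smul, map_mul, diagonalCharacter_eval_quasiIdemPoly,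
      diagonalCharacter_eval_momentPoly, diagonalCharacter_eval_traceQuasiIdemPoly, smul_eq_mul,
      AlgTrace.eval_varPoly]
    fin_cases i <;>
    · simp [diagonalTrace_apply]
      try ring
  have h2 := h h1 fun i => if i = 0 then x else y
  rw [← sub_eq_zero, ← h2]
  simp [AlgTrace.eval_quasiIdemPoly, AlgTrace.eval_momentPoly,
    AlgTrace.eval_traceQuasiIdemPoly, Algebra.smul_def]
  ring

end DiagonalIdentities

/-! ### Identities of D_2 with equal weights -/

section SymmetricIdentities

variable {F : Type u} [Field F] {A : Type v} [CommRing A] [Algebra F A]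

/-- At diag(a, b) the factor is γ(a-b) diag(1, -1), whose square is scalar. -/
theorem AlgTrace.MemVariety.symm_sq {t : AlgTrace F A} {γ : F}
    (h : t.MemVariety (diagonalTrace ![γ, γ])) (x : A) :
    ((γ + γ) • x - algebraMap F A (t.toLinearMap x)) *
      ((γ + γ) • x - algebraMap F A (t.toLinearMap x)) =
        algebraMap F A (t.disc (γ + γ) x) := by
  have h1 : ((γ + γ) • varPoly F 0 - tracePoly F 0 []) *
      ((γ + γ) • varPoly F 0 - tracePoly F 0 []) - discPoly (γ + γ) ∈
      (diagonalTrace ![γ, γ]).identities := mem_identities_diagonal fun a i => by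
    simp only [map_sub, map_smul, map_mul, diagonalCharacter_eval_discPoly]
    fin_cases i <;>
    · simp [diagonalTrace_apply]
      ring
  have h2 := h h1 fun _ => x
  simpa only [map_sub, map_smul, map_mul, AlgTrace.eval_discPoly, AlgTrace.eval_varPoly,
    AlgTrace.eval_tracePoly, List.map_nil, List.prod_nil, mul_one, sub_eq_zero] using h2

/-- Expansion of y in the trace-orthogonal basis 1, diag(1, -1) of D_2. Where the discriminant is
nonzero, it shows that 1 and the traceless part of x span A. -/
theorem AlgTrace.MemVariety.symm_smul {t : AlgTrace F A} {γ : F}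
    (h : t.MemVariety (diagonalTrace ![γ, γ])) (x y : A) :
    ((γ + γ) * t.disc (γ + γ) x) • y =
      algebraMap F A (t.disc (γ + γ) x * t.toLinearMap y) +
        t.toLinearMap (((γ + γ) • x - algebraMap F A (t.toLinearMap x)) * y) •
          ((γ + γ) • x - algebraMap F A (t.toLinearMap x)) := by
  have h1 : (γ + γ) • (discPoly (γ + γ) * varPoly F 1) -
      (discPoly (γ + γ) * tracePoly F 1 [] +
        ((γ + γ) • tracePoly F 0 [1] - tracePoly F 0 [] * tracePoly F 1 []) *
          ((γ + γ) • varPoly F 0 - tracePoly F 0 [])) ∈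
      (diagonalTrace ![γ, γ]).identities := mem_identities_diagonal fun a i => by
    simp only [map_sub, map_smul, map_mul, map_add, diagonalCharacter_eval_discPoly]
    fin_cases i <;>
    · simp [diagonalTrace_apply]
      ring
  have h2 := h h1 fun i => if i = 0 then x else y
  have h3 : t.toLinearMap (((γ + γ) • x - algebraMap F A (t.toLinearMap x)) * y) =
      (γ + γ) * t.toLinearMap (x * y) - t.toLinearMap x * t.toLinearMap y := by
    rw [sub_mul, smul_mul_assoc, ← Algebra.smul_def, map_sub, map_smul, map_smul, smul_eq_mul,
      smul_eq_mul]
  rw [← sub_eq_zero, ← h2, h3]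
  simp [AlgTrace.eval_discPoly, Algebra.smul_def]
  ring

end SymmetricIdentities

/-! ### Algebras containing a traceless square root of a scalar -/

section SymmetricForms

variable {F : Type u} [Field F] {A : Type v} {B : Type w}

/-- The trace `p ↦ γ (p(X) + p(-X))` on polynomials; at a square root of a scalar it specialises
to the trace of a quadratic extension. -/
noncomputable def reflectionTrace (γ : F) : Polynomial F →ₗ[F] Polynomial F :=
  γ • (LinearMap.id + (Polynomial.aeval (-Polynomial.X : Polynomial F)).toLinearMap)

/-- Even powers of v are scalars, on which γ(p(v) + p(-v)) doubles, matching tr(1) = 2γ; odd powers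
are multiples of v and have trace zero. The formula for the trace does not involve κ. -/
theorem AlgTrace.aeval_reflectionTrace [CommRing A] [Algebra F A] (t : AlgTrace F A) {γ κ : F}
    {v : A} (hv : v * v = algebraMap F A κ) (h1 : t.toLinearMap 1 = γ + γ)
    (htv : t.toLinearMap v = 0) (p : Polynomial F) :
    Polynomial.aeval v (reflectionTrace γ p) =
      algebraMap F A (t.toLinearMap (Polynomial.aeval v p)) := by
  induction p using Polynomial.induction_on' with
  | add p q hp hq => simp only [map_add, hp, hq]
  | monomial n c =>
    have hpow : ∀ j : ℕ, v ^ (j + j) = algebraMap F A (κ ^ j) := fun j => by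
      rw [← two_mul, pow_mul, pow_two, hv, map_pow]
    have e : Polynomial.aeval v (reflectionTrace γ (Polynomial.monomial n c)) =
        algebraMap F A (γ * c) * (v ^ n + (-v) ^ n) := by
      simp [reflectionTrace, Polynomial.aeval_monomial, Algebra.smul_def]
      ring
    rw [e, Polynomial.aeval_monomial]
    rcases Nat.even_or_odd n with hn | hn
    · rw [hn.neg_pow]
      obtain ⟨j, rfl⟩ := hn
      rw [hpow, ← map_mul, Algebra.algebraMap_eq_smul_one (c * κ ^ j), map_smul, h1, ← map_add,
        ← map_mul]
      congr 1
      rw [smul_eq_mul]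
      ring
    · rw [hn.neg_pow, add_neg_cancel, mul_zero]
      obtain ⟨j, rfl⟩ := hn
      rw [pow_succ, two_mul, hpow, ← mul_assoc, ← map_mul, ← Algebra.smul_def, map_smul, htv,
        smul_zero, map_zero]

theorem AlgTrace.identities_subset_of_sqrt_aux [Infinite F] [CommRing A] [Nontrivial A]
    [Algebra F A] [CommRing B] [Algebra F B] (t : AlgTrace F A) (s : AlgTrace F B) {γ κ κ' : F}
    {v : A} {w : B} (hκ : κ ≠ 0) (hv : v * v = algebraMap F A κ)
    (hw : w * w = algebraMap F B κ') (ht : t.toLinearMap 1 = γ + γ) (htv : t.toLinearMap v = 0)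
    (hs : s.toLinearMap 1 = γ + γ) (hsw : s.toLinearMap w = 0)
    (hB : ∀ b : B, ∃ c d : F, b = algebraMap F B c + d • w) :
    t.identities ⊆ s.identities := by
  intro f hf b
  choose c d hcd using fun i => hB (b i)
  set P := endoEval (reflectionTrace γ)
    (fun i => Polynomial.C (c i) + d i • Polynomial.X) f with hP
  have hvpow : ∀ j : ℕ, v ^ j ≠ 0 := by
    intro j hj
    have := congrArg (fun z => z * v ^ j) hj
    simp only [← mul_pow, hv, zero_mul, ← map_pow, map_eq_zero] at this
    exact pow_ne_zero j hκ this
  -- Every multiple r v is again a traceless square root of a scalar, so the same generic P serves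
  -- for all r; separating powers of r gives P = 0.
  have hA : ∀ r : F, Polynomial.aeval (r • v) P = 0 := by
    intro r
    rw [hP, ← t.eval_comp (reflectionTrace γ) (Polynomial.aeval (r • v)) fun p =>
      t.aeval_reflectionTrace (κ := r * r * κ)
        (by rw [smul_mul_smul_comm, hv, map_mul, ← Algebra.smul_def]) ht (by simp [htv]) p]
    exact hf _
  have hP0 : P = 0 := by
    ext j
    by_cases hj : j ∈ Finset.range (P.natDegree + 1)
    · have := eq_zero_of_sum_pow_smul_eq_zero (F := F) (Finset.range (P.natDegree + 1))
        (fun j => P.coeff j • v ^ j) (fun r => by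
          rw [← hA r, Polynomial.aeval_eq_sum_range]
          refine Finset.sum_congr rfl fun i _ => ?_
          rw [smul_pow, smul_comm]) j hj
      exact (smul_eq_zero.1 this).resolve_right (hvpow j)
    · rw [Polynomial.coeff_zero]
      exact Polynomial.coeff_eq_zero_of_natDegree_lt (by simpa using hj)
  have hb : s.eval b f = Polynomial.aeval w P := by
    rw [hP, ← s.eval_comp (reflectionTrace γ) (Polynomial.aeval w) fun p =>
      s.aeval_reflectionTrace hw hs hsw p]
    congr 1
    congr 1
    funext i
    simp [← hcd]
  rw [hb, hP0, map_zero]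

theorem AlgTrace.identities_subset_of_sqrt [Infinite F] [Ring A] [Nontrivial A]
    [Algebra F A] [Ring B] [Algebra F B] (hcA : ∀ x y : A, x * y = y * x)
    (hcB : ∀ x y : B, x * y = y * x) (t : AlgTrace F A) (s : AlgTrace F B) {γ κ κ' : F}
    {v : A} {w : B} (hκ : κ ≠ 0) (hv : v * v = algebraMap F A κ)
    (hw : w * w = algebraMap F B κ') (ht : t.toLinearMap 1 = γ + γ) (htv : t.toLinearMap v = 0)
    (hs : s.toLinearMap 1 = γ + γ) (hsw : s.toLinearMap w = 0)
    (hB : ∀ b : B, ∃ c d : F, b = algebraMap F B c + d • w) :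
    t.identities ⊆ s.identities := by
  let _ : CommRing A := { ‹Ring A› with mul_comm := hcA }
  let _ : CommRing B := { ‹Ring B› with mul_comm := hcB }
  exact AlgTrace.identities_subset_of_sqrt_aux t s hκ hv hw ht htv hs hsw hB

end SymmetricForms

/-! ### The varieties of D_2 with two nonzero weights -/

section DiagonalVariety

variable {F : Type u} [Field F] [CharZero F] {A : Type v} [CommRing A] [Nontrivial A]
  [Algebra F A]

theorem AlgTrace.exists_tEquiv_toeplitz_of_disc_eq_zero (t : AlgTrace F A) {α β : F}
    (hα : α ≠ 0) (hβ : β ≠ 0) (h : t.MemVariety (diagonalTrace ![α, β]))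
    (hdisc : ∀ x, t.disc (α + β) x = 0) :
    ∃ (k : ℕ) (_ : NeZero k), t.TEquiv (toeplitzTrace k (t.toLinearMap 1)) := by
  set s := α + β with hs
  by_cases hs0 : s = 0
  · exact t.exists_tEquiv_toeplitz_of_zero fun x => by
      simpa [AlgTrace.disc, hs0] using hdisc x
  have hnil : ∀ x, (x - algebraMap F A ((s⁻¹ • t.toLinearMap) x)) ^ 4 = 0 := by
    intro x
    have h1 := (smul_eq_zero.1 (h.disc_pow_four x (hdisc x))).resolve_left (mul_ne_zero hα hβ)
    rw [← hs] at h1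
    have h2 : s • (x - algebraMap F A ((s⁻¹ • t.toLinearMap) x)) =
        s • x - algebraMap F A (t.toLinearMap x) := by
      rw [smul_sub, Algebra.smul_def _ (algebraMap F A _), ← map_mul, LinearMap.smul_apply,
        smul_eq_mul, mul_inv_cancel_left₀ hs0]
    rw [← h2, smul_pow] at h1
    exact (smul_eq_zero.1 h1).resolve_left (pow_ne_zero 4 hs0)
  obtain ⟨χ, hχ⟩ := exists_algHom_of_isNilpotent_sub (s⁻¹ • t.toLinearMap) fun y => ⟨4, hnil y⟩
  refine t.exists_tEquiv_toeplitz χ s (fun x => ?_) ⟨4, fun x hx => ?_⟩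
  · rw [hχ, LinearMap.smul_apply, smul_eq_mul, mul_inv_cancel_left₀ hs0]
  · have := hnil x
    rwa [← hχ, hx, map_zero, sub_zero] at this

theorem AlgTrace.tEquiv_diagonal_of_ne_or (t : AlgTrace F A) {α β : F} (hα : α ≠ 0) (hβ : β ≠ 0)
    (hαβ : α ≠ β) (h : t.MemVariety (diagonalTrace ![α, β])) :
    t.TEquiv (diagonalTrace ![α, β]) ∨
      ∃ (k : ℕ) (_ : NeZero k), t.TEquiv (toeplitzTrace k (t.toLinearMap 1)) := by
  by_cases hdisc : ∀ x, t.disc (α + β) x = 0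
  · exact Or.inr (t.exists_tEquiv_toeplitz_of_disc_eq_zero hα hβ h hdisc)
  push Not at hdisc
  obtain ⟨x, hx⟩ := hdisc
  set l := 2 * t.moment (α + β) x with hl
  have hl0 : l ≠ 0 := by
    intro hl0
    have hm : t.moment (α + β) x = 0 := by simpa [hl] using hl0
    have := h.moment_sq x
    rw [hm, zero_pow two_ne_zero, mul_zero] at this
    exact mul_ne_zero (pow_ne_zero 2 (sub_ne_zero.2 hαβ.symm)) (pow_ne_zero 3 hx) this.symm
  -- Dividing by l turns the quasi-idempotent into a genuine idempotent.
  obtain ⟨e, he⟩ : ∃ e, t.quasiIdem α β x = l • e :=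
    ⟨l⁻¹ • t.quasiIdem α β x, by rw [smul_smul, mul_inv_cancel₀ hl0, one_smul]⟩
  have hll : l * l ≠ 0 := mul_ne_zero hl0 hl0
  have hee : e * e = e := by
    have := h.quasiIdem_mul_self x
    rw [he, ← hl, smul_mul_smul_comm, smul_smul] at this
    exact smul_right_injective A hll this
  have hey : ∀ y, α • (e * y) = t.toLinearMap (e * y) • e := by
    intro y
    have := h.quasiIdem_mul x y
    rw [he, ← hl, smul_mul_assoc, map_smul, smul_smul, smul_smul, smul_eq_mul] at this
    apply smul_right_injective A hll
    simp only [smul_smul]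
    convert this using 2 <;> ring
  have hfy : ∀ y, β • ((1 - e) * y) = (t.toLinearMap y - t.toLinearMap (e * y)) • (1 - e) := by
    intro y
    have := h.sub_quasiIdem_mul x y
    rw [he, ← hl, Algebra.algebraMap_eq_smul_one, ← smul_sub, smul_mul_assoc, smul_mul_assoc,
      map_smul, smul_smul, smul_smul, smul_eq_mul] at this
    apply smul_right_injective A hll
    simp only [smul_smul]
    convert this using 2 <;> ring
  -- A trivial idempotent makes A itself one-dimensional; otherwise e and 1 - e have traces α and β
  -- and span a copy of D_2.
  by_cases he1 : e = 1
  · right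
    refine t.exists_tEquiv_toeplitz_of_scalar fun y => ⟨α⁻¹ * t.toLinearMap y, ?_⟩
    have := hey y
    rw [he1, one_mul] at this
    rw [map_mul, ← Algebra.smul_def, Algebra.algebraMap_eq_smul_one, ← this, smul_smul,
      inv_mul_cancel₀ hα, one_smul]
  by_cases he0 : e = 0
  · right
    refine t.exists_tEquiv_toeplitz_of_scalar fun y => ⟨β⁻¹ * t.toLinearMap y, ?_⟩
    have := hfy y
    rw [he0, zero_mul, map_zero, sub_zero, sub_zero, one_mul] at this
    rw [map_mul, ← Algebra.smul_def, Algebra.algebraMap_eq_smul_one, ← this, smul_smul,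
      inv_mul_cancel₀ hβ, one_smul]
  left
  have hf0 : 1 - e ≠ 0 := sub_ne_zero.2 (Ne.symm he1)
  have hte : t.toLinearMap e = α := by
    have := hey 1
    rw [mul_one] at this
    exact (smul_left_injective F he0 this).symm
  have htf : t.toLinearMap (1 - e) = β := by
    have := hfy 1
    rw [mul_one, mul_one, ← map_sub] at this
    exact (smul_left_injective F hf0 this).symm
  let ψ : diagonalAlgebra F 2 →ₐ[F] A := AlgHom.ofLinearMap
    { toFun := fun y => diagonalCharacter F 0 y • e + diagonalCharacter F 1 y • (1 - e)
      map_add' := fun y z => by simp only [map_add, add_smul]; ring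
      map_smul' := fun c y => by simp only [map_smul, smul_assoc, smul_add, RingHom.id_apply] }
    (by simp)
    (fun y z => by
      simp only [LinearMap.coe_mk, AddHom.coe_mk, map_mul, Algebra.smul_def]
      linear_combination (-(algebraMap F A (diagonalCharacter F 0 y) -
        algebraMap F A (diagonalCharacter F 1 y)) * (algebraMap F A (diagonalCharacter F 0 z) -
        algebraMap F A (diagonalCharacter F 1 z))) * hee)
  have hψ : ∀ y, ψ y = diagonalCharacter F 0 y • e + diagonalCharacter F 1 y • (1 - e) :=
    fun _ => rfl
  refine Set.Subset.antisymm (t.identities_subset_of_injective _ ψ ?_ fun y => ?_) h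
  · rw [injective_iff_map_eq_zero]
    intro y hy
    rw [hψ] at hy
    have h0 := congrArg (fun z => e * z) hy
    have h1 := congrArg (fun z => (1 - e) * z) hy
    have hef : e * (1 - e) = 0 := by rw [mul_sub, mul_one, hee, sub_self]
    have hff : (1 - e) * (1 - e) = 1 - e := by rw [mul_sub, mul_one, _root_.mul_comm, hef, sub_zero]
    simp only [mul_add, mul_smul_comm, hee, hef, smul_zero, add_zero, mul_zero] at h0
    simp only [mul_add, mul_smul_comm, _root_.mul_comm (1 - e) e, hff, hef, smul_zero, zero_add,
      mul_zero] at h1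
    refine diagonalAlgebra_ext fun i => ?_
    rw [map_zero]
    fin_cases i
    · exact (smul_eq_zero.1 h0).resolve_right he0
    · exact (smul_eq_zero.1 h1).resolve_right hf0
  · rw [hψ, diagonalTrace_apply, map_add, map_smul, map_smul, hte, htf, smul_eq_mul, smul_eq_mul,
      _root_.mul_comm α, _root_.mul_comm β]

theorem AlgTrace.tEquiv_diagonal_self_or (t : AlgTrace F A) {γ : F} (hγ : γ ≠ 0)
    (h : t.MemVariety (diagonalTrace ![γ, γ])) :
    t.TEquiv (diagonalTrace ![γ, γ]) ∨
      ∃ (k : ℕ) (_ : NeZero k), t.TEquiv (toeplitzTrace k (t.toLinearMap 1)) := by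
  by_cases hdisc : ∀ x, t.disc (γ + γ) x = 0
  · exact Or.inr (t.exists_tEquiv_toeplitz_of_disc_eq_zero hγ hγ h hdisc)
  push Not at hdisc
  obtain ⟨x, hx⟩ := hdisc
  have hγγ : γ + γ ≠ 0 := by rw [← two_mul]; exact mul_ne_zero two_ne_zero hγ
  have hsq := h.symm_sq x
  have hlin := h.symm_smul x
  set v := (γ + γ) • x - algebraMap F A (t.toLinearMap x) with hv
  set D := t.disc (γ + γ) x with hD
  -- A is spanned by 1 and v, so a scalar v leaves only scalars.
  by_cases hvs : ∃ c, v = algebraMap F A c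
  · right
    obtain ⟨c, hc⟩ := hvs
    refine t.exists_tEquiv_toeplitz_of_scalar fun y =>
      ⟨((γ + γ) * D)⁻¹ * (D * t.toLinearMap y + t.toLinearMap (v * y) * c), ?_⟩
    apply smul_right_injective A (mul_ne_zero hγγ hx)
    simp only
    rw [hlin y, Algebra.smul_def ((γ + γ) * D), ← map_mul, mul_inv_cancel_left₀
      (mul_ne_zero hγγ hx), map_add, map_mul _ (t.toLinearMap (v * y)), ← hc, ← Algebra.smul_def]
  left
  have h1 := hlin 1
  rw [mul_one] at h1
  -- Expanding y = 1 writes tr(v) v as a scalar; since v is not a scalar, tr(v) = 0, and then tr(1)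
  -- = 2γ.
  have htv : t.toLinearMap v = 0 := by
    by_contra htv
    refine hvs ⟨(t.toLinearMap v)⁻¹ * ((γ + γ) * D - D * t.toLinearMap 1), ?_⟩
    rw [map_mul, map_sub (algebraMap F A), ← Algebra.smul_def,
      Algebra.algebraMap_eq_smul_one ((γ + γ) * D), h1,
      add_sub_cancel_left, smul_smul, inv_mul_cancel₀ htv, one_smul]
  have ht1 : t.toLinearMap 1 = γ + γ := by
    rw [htv, zero_smul, add_zero, ← Algebra.algebraMap_eq_smul_one] at h1
    have := (algebraMap F A).injective h1
    rw [_root_.mul_comm] at this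
    exact (mul_left_cancel₀ hx this).symm
  -- D need not be a square in F, so D_2 may not embed in A; v and diag(1, -1) are matched only as
  -- traceless square roots of scalars.
  obtain ⟨w, hw⟩ := exists_diagonalCharacter_eq (F := F) ![1, -1]
  have hw0 : diagonalCharacter F 0 w = 1 := hw 0
  have hw1 : diagonalCharacter F 1 w = -1 := hw 1
  refine Set.Subset.antisymm (AlgTrace.identities_subset_of_sqrt (A := A)
    (B := diagonalAlgebra F 2) _root_.mul_comm diagonalAlgebra_comm t (diagonalTrace ![γ, γ])
    (γ := γ) (κ := D) (κ' := 1) (v := v) (w := w) hx hsq ?_ ht1 htv ?_ ?_ fun b => ?_) h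
  · refine diagonalAlgebra_ext fun i => ?_
    fin_cases i <;> simp [hw0, hw1]
  · simp [diagonalTrace_apply]
  · simp [diagonalTrace_apply, hw0, hw1]
  · refine ⟨(diagonalCharacter F 0 b + diagonalCharacter F 1 b) / 2,
      (diagonalCharacter F 0 b - diagonalCharacter F 1 b) / 2, diagonalAlgebra_ext fun i => ?_⟩
    fin_cases i <;> simp [hw0, hw1] <;> ring

end DiagonalVariety

end TraceAlgebra

/-! ### Assembly of the four cases -/

theorem mainTheorem10 {F : Type*} [Field F] [CharZero F]
    {A : Type*} [Ring A] [Nontrivial A] [Algebra F A] [FiniteDimensional F A]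
    (tr : TraceAlgebra.AlgTrace F A) :
    (∀ α' β : F, α' ≠ 0 → β ≠ 0 → α' ≠ β →
      tr.MemVariety (TraceAlgebra.diagonalTrace ![α', β]) →
        tr.TEquiv (TraceAlgebra.diagonalTrace ![α', β]) ∨
        ∃ (k : ℕ) (_ : NeZero k), tr.TEquiv (TraceAlgebra.toeplitzTrace k (tr.toLinearMap 1))) ∧
    (∀ γ : F, γ ≠ 0 →
      tr.MemVariety (TraceAlgebra.diagonalTrace ![γ, γ]) →
        tr.TEquiv (TraceAlgebra.diagonalTrace ![γ, γ]) ∨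
        ∃ (k : ℕ) (_ : NeZero k), tr.TEquiv (TraceAlgebra.toeplitzTrace k (tr.toLinearMap 1))) ∧
    (∀ δ : F, δ ≠ 0 →
      tr.MemVariety (TraceAlgebra.diagonalTrace ![δ, 0]) →
        tr.TEquiv (TraceAlgebra.diagonalTrace ![δ, 0]) ∨
        ∃ (k : ℕ) (_ : NeZero k), tr.TEquiv (TraceAlgebra.toeplitzTrace k (tr.toLinearMap 1))) ∧
    (∀ ε : F,
      tr.MemVariety (TraceAlgebra.strangeTrace ε 1) →
        tr.TEquiv (TraceAlgebra.strangeTrace ε 1) ∨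
        ∃ (k : ℕ) (_ : NeZero k), tr.TEquiv (TraceAlgebra.toeplitzTrace k (tr.toLinearMap 1))) := by
  refine ⟨fun α' β hα hβ hne h => ?_, fun γ hγ h => ?_, fun δ hδ h => ?_, fun ε h => ?_⟩
  · let _ : CommRing A := { ‹Ring A› with mul_comm := h.mul_comm TraceAlgebra.diagonalAlgebra_comm }
    exact TraceAlgebra.AlgTrace.tEquiv_diagonal_of_ne_or tr hα hβ hne h
  · let _ : CommRing A := { ‹Ring A› with mul_comm := h.mul_comm TraceAlgebra.diagonalAlgebra_comm }
    exact TraceAlgebra.AlgTrace.tEquiv_diagonal_self_or tr hγ h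
  · let _ : CommRing A := { ‹Ring A› with mul_comm := h.mul_comm TraceAlgebra.diagonalAlgebra_comm }
    exact TraceAlgebra.AlgTrace.tEquiv_diagonal_zero_or tr δ hδ h
  · let _ : CommRing A := { ‹Ring A› with mul_comm := h.mul_comm TraceAlgebra.toeplitzAlgebra_comm }
    exact TraceAlgebra.AlgTrace.tEquiv_strange_or tr ε h
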